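/- **Common syntax and reduction.** Both calculi extend the untyped call-by-push-value language MAM; terms are taken up to $\alpha$-equivalence. Values: $V ::= x \mid () \mid l \mid (V,W) \mid \mathbf{inj}_L V \mid \{M\}$, with $l$ a label from a countably infinite set. Computations: $M ::= \mathbf{case}\,V\,\mathbf{of}\,(x_1,x_2)\mapsto M \mid \mathbf{case}\,V\,\mathbf{of}\,\{\mathbf{inj}_{L_i}x_i\mapsto M_i\}_i \mid V! \mid \mathbf{return}\,V \mid x\leftarrow M;N \mid \lambda x.M \mid M\,V \mid \langle M,N\rangle \mid \mathbf{prj}_i M$ (we also write $\mathbf{let}\,x=M\,\mathbf{in}\,N$ for $x\leftarrow M;N$). A store $\theta$ is a finite partial map from labels to stored objects or $\mathbf{nil}$; a configuration is $\bot$ or a pair $\langle M,\theta\rangle$. The common $\beta$-steps, which do not change the store, are the usual ones: $\mathbf{case}\,(V_1,V_2)\,\mathbf{of}\,(x_1,x_2)\mapsto M \to M[V_1/x_1,V_2/x_2]$; $\mathbf{case}\,\mathbf{inj}_{L_j}V\,\mathbf{of}\,\{\dots\}\to M_j[V/x_j]$; $\{M\}!\to M$; $x\leftarrow\mathbf{return}\,V;M\to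 M[V/x]$; $(\lambda x.M)\,V\to M[V/x]$; $\mathbf{prj}_i\langle M_1,M_2\rangle\to M_i$. Pure contexts: $H ::= [\,] \mid x\leftarrow H;N \mid H\,V\mid \mathbf{prj}_i H$. A label is fresh if it is not in the domain of the store. **$\mathrm{DEL}_{one}$** adds the computations $\mathbf{shift}\,k.M$, the dollar term $\langle M\mid x.N\rangle$ and $\mathbf{throw}\,V\,W$. Evaluation contexts $C$ are built like pure contexts, with the additional frame $\langle C\mid x.N\rangle$. Stored objects are captured continuations $\lambda y.\langle H[\mathbf{return}\,y]\mid x.M\rangle$ with $y$ not free in $H,M$. Additional $\beta$-steps: - (ret) $\langle\,\langle \mathbf{return}\,V\mid x.M\rangle,\theta\rangle\to\langle M[V/x],\theta\rangle$; - (shift) $\langle\,\langle H[\mathbf{shift}\,k.M]\mid x.N\rangle,\theta\rangle\to\langle M[l/k],\theta[l:=\lambda y.\langle H[\mathbf{return}\,y]\mid x.N\rangle]\rangle$ with $l$ fresh; - (throw) if $\theta(l)=\lambda y.\langle H[\mathbf{return}\,y]\mid x.N\rangle$, then $\langle\mathbf{throw}\,l\,V,\theta\rangle\to\langle\,\langle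 H[\mathbf{return}\,V]\mid x.N\rangle,\theta[l:=\mathbf{nil}]\rangle$; - (fail) if $\theta(l)=\mathbf{nil}$, then $\langle\mathbf{throw}\,l\,V,\theta\rangle\to\bot$. **$\mathrm{AC}$** (asymmetric coroutines) adds $\mathbf{create}\,V$, $\mathbf{resume}\,V\,W$, $\mathbf{yield}\,V$ and labelled computations $l:M$. Evaluation contexts $D$ have the additional frame $l:D$; stored objects are values. Additional $\beta$-steps: - (create) $\langle\mathbf{create}\,V,\tau\rangle\to\langle\mathbf{return}\,l,\tau[l:=V]\rangle$ with $l$ fresh; - (resume) if $\tau(l)=V$ is a value, $\langle\mathbf{resume}\,l\,W,\tau\rangle\to\langle l:(V!\,W),\tau[l:=\mathbf{nil}]\rangle$; - (fail) if $\tau(l)=\mathbf{nil}$, $\langle\mathbf{resume}\,l\,W,\tau\rangle\to\bot$; - (ret) $\langle l:\mathbf{return}\,V,\tau\rangle\to\langle\mathbf{return}\,V,\tau\rangle$; - (yield) $\langle l:H[\mathbf{yield}\,V],\tau\rangle\to\langle\mathbf{return}\,V,\tau[l:=\{\lambda y.H[\mathbf{return}\,y]\}]\rangle$. The reduction $\to_{AC}$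 is the closure of these steps under evaluation contexts, where a step to $\bot$ inside any context is a step to $\bot$; $\to_{AC}^{+}$ is its transitive closure. The set $\mathrm{AL}(E)$ of active labels consists of all $l$ such that some $l:M$ occurs in $E$. The predicate $\mathrm{WF}(M)$ is defined inductively: $x\leftarrow M;N$, $M\,V$ and $\mathbf{prj}_iM$ are WF if $M$ is WF and $N$, respectively $V$, has no active labels; $l:M$ is WF if $M$ is WF and $l\notin\mathrm{AL}(M)$; every other computation is WF if it has no active labels. A configuration $\langle M,\tau\rangle$ is *well-formed* if $\mathrm{WF}(M)$, no value stored in $\tau$ has active labels, and $\tau(l)=\mathbf{nil}$ for all $l\in\mathrm{AL}(M)$. **Auxiliary $\mathrm{AC}$-programs.** Numbers are written in unary: $0=\mathbf{inj}_{Zero}()$, $n+1=\mathbf{inj}_{Succ}\,n$. Let $\mathit{incr}=\{\lambda n.\mathbf{return}\,\mathbf{inj}_{Succ}n\}$, and let $\mathit{compare}$ be the equality test of numerals with results $\mathbf{inj}_{True}()$ and $\mathbf{inj}_{False}()$, defined by self-application: $\mathit{compare}=\{q!\,q\}$ with $$q=\{\lambda f.\lambda a.\lambda b.\,\mathbf{case}\,a\,\mathbf{of}\,\{\mathbf{inj}_{Zero}\_\mapsto\mathbf{case}\,b\,\mathbf{of}\,\{\mathbf{inj}_{Zero}\_\mapsto\mathbf{return}\,\mathbf{inj}_{True}();\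 \mathbf{inj}_{Succ}\_\mapsto\mathbf{return}\,\mathbf{inj}_{False}()\};\ \mathbf{inj}_{Succ}a'\mapsto\mathbf{case}\,b\,\mathbf{of}\,\{\mathbf{inj}_{Zero}\_\mapsto\mathbf{return}\,\mathbf{inj}_{False}();\ \mathbf{inj}_{Succ}b'\mapsto f!\,f\,a'\,b'\}\}\}.$$ Reference cells are coroutines: with $$s=\{\lambda f.\lambda v.\lambda c.\,\mathbf{case}\,c\,\mathbf{of}\,\{\mathbf{inj}_{Get}\_\mapsto c'\leftarrow\mathbf{yield}\,v;\,f!\,f\,v\,c';\ \mathbf{inj}_{Set}w\mapsto c'\leftarrow\mathbf{yield}\,();\,f!\,f\,w\,c'\}\}$$ let $\mathrm{refcell}(V)=\{\lambda y.\,c\leftarrow\mathbf{return}\,y;\,s!\,s\,V\,c\}$, $\mathit{ref}=\{\lambda v.\mathbf{create}\,\mathrm{refcell}(v)\}$, $\mathit{get}=\{\lambda r.\mathbf{resume}\,r\,(\mathbf{inj}_{Get}())\}$, $\mathit{set}=\{\lambda r.\lambda v.\mathbf{resume}\,r\,(\mathbf{inj}_{Set}v)\}$. Let $\mathit{fail}=\{z\leftarrow\mathbf{create}\,\{\lambda\_.\mathbf{return}\,()\};\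 \_\leftarrow\mathbf{resume}\,z\,();\ \mathbf{resume}\,z\,()\}$. We write $\mathrm{getnum}(l,\tau)=i$ if $\tau(l)=\mathrm{refcell}(i)$. **Macro-translation.** Let $\eta$ be a partial function from $\mathrm{DEL}_{one}$-labels to triples $(z,zc,i)$ of two $\mathrm{AC}$-labels and a natural number. The translation $[\![E]\!]_\eta$ of expressions and pure contexts is defined if all labels of $E$ are in $\mathrm{dom}\,\eta$. It commutes with all constructs of MAM, and - $[\![l]\!]_\eta=((z,zc),i)$ if $\eta(l)=(z,zc,i)$; - $[\![\mathbf{shift}\,k.M]\!]_\eta=\mathbf{yield}\,\{\lambda k.[\![M]\!]_\eta\}$; - $[\![\langle M\mid x.N\rangle]\!]_\eta=\mathbf{let}\,z=\mathbf{create}\,\{\lambda\_.\,x\leftarrow[\![M]\!]_\eta;\mathbf{return}\,\{\lambda\_.[\![N]\!]_\eta\}\}\,\mathbf{in}\ \mathbf{let}\,zc=\mathit{ref}!\,0\,\mathbf{in}\ \mathbf{let}\,res=\mathbf{resume}\,z\,()\,\mathbf{in}\ res!\,((z,zc),0)$; - $[\![\mathbf{throw}\,V\,W]\!]_\eta=\mathbf{case}\,[\![V]\!]_\eta\,\mathbf{of}\,((z,zc),i)\mapsto\mathbf{let}\,j=\mathit{get}!\,zc\,\mathbf{in}\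 \mathbf{let}\,b=\mathit{compare}!\,i\,j\,\mathbf{in}\ \mathbf{case}\,b\,\mathbf{of}\,\{\mathbf{inj}_{True}\_\mapsto\mathbf{let}\,i'=\mathit{incr}!\,i\,\mathbf{in}\ \mathbf{let}\,\_=\mathit{set}!\,zc\,i'\,\mathbf{in}\ \mathbf{let}\,res=\mathbf{resume}\,z\,[\![W]\!]_\eta\,\mathbf{in}\ res!\,((z,zc),i');\ \mathbf{inj}_{False}\_\mapsto\mathit{fail}!\}$, where a nested pair pattern is matched one level after the other and all bound variables other than those of the source are chosen fresh. **The relation $\sim_{\eta,\kappa}$.** Let also $\kappa$ be a partial function from $\mathrm{AC}$-labels to $\mathrm{AC}$-labels. The relation $\langle M,\theta\rangle\sim_{\eta,\kappa}\langle N,\tau\rangle$ is defined inductively; all translations that occur are required to be defined: 1. $\langle M,\theta\rangle\sim_{\eta,\kappa}\langle[\![M]\!]_\eta,\tau\rangle$ if $M$ is a pair case, a variant case, $V!$, $\mathbf{return}\,V$, $\lambda x.M'$, $\langle M_1,M_2\rangle$, a $\mathbf{shift}$, a dollar term, or a $\mathbf{throw}$; 2. if $\langle M,\theta\rangle\sim_{\eta,\kappa}\langle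 N,\tau\rangle$, then $\langle x\leftarrow M;M_2,\theta\rangle\sim_{\eta,\kappa}\langle x\leftarrow N;[\![M_2]\!]_\eta,\tau\rangle$, $\langle M\,V,\theta\rangle\sim_{\eta,\kappa}\langle N\,[\![V]\!]_\eta,\tau\rangle$ and $\langle\mathbf{prj}_iM,\theta\rangle\sim_{\eta,\kappa}\langle\mathbf{prj}_iN,\tau\rangle$; 3. if $\langle M_1,\theta\rangle\sim_{\eta,\kappa}\langle N_1,\tau\rangle$, $\mathrm{getnum}(\kappa(m),\tau)=i$, $\tau(m)=\mathbf{nil}$, and $\theta(l)=\mathbf{nil}$ for every $l$ with $\eta(l)=(m,\kappa(m),j)$ for some $j$, then $\langle\,\langle M_1\mid x.M_2\rangle,\theta\rangle\sim_{\eta,\kappa}\langle\,\mathbf{let}\,res=m:(x\leftarrow N_1;\mathbf{return}\,\{\lambda\_.[\![M_2]\!]_\eta\})\,\mathbf{in}\ res!\,((m,\kappa(m)),i),\ \tau\rangle$. **The simulation relation.** For configurations $C$ of $\mathrm{DEL}_{one}$ and $D$ of $\mathrm{AC}$, $C\sim D$ means that $C=D=\bot$, or that $C=\langle M,\theta\rangle$,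 $D=\langle N,\tau\rangle$, $D$ is well-formed, and for some $\eta,\kappa$ as above $C\sim_{\eta,\kappa}D$ and the following invariant conditions hold: - $\kappa$ is injective, $\mathrm{dom}\,\kappa\cap\mathrm{im}\,\kappa=\emptyset$, $\mathrm{dom}\,\kappa\cup\mathrm{im}\,\kappa=\mathrm{dom}\,\tau$, and $\mathrm{dom}\,\eta=\mathrm{dom}\,\theta$; - if $\eta(l)=(z,zc,i)$, then $\kappa(z)=zc$; - if $\eta(l)=(z,zc,i)$ and $\theta(l)=\mathbf{nil}$, then $\mathrm{getnum}(zc,\tau)>i$; - if $\eta(l)=(z,zc,i)$ and $\theta(l)=\lambda y.\langle H[\mathbf{return}\,y]\mid x.M'\rangle$, then $l$ does not occur in $M'$; $\mathrm{getnum}(zc,\tau)=i$; $\theta(l')=\mathbf{nil}$ for every $l'\in\mathrm{dom}\,\theta$ with $l'\neq l$ for which the first component of $\eta(l')$ is $z$; and $\tau(z)=\{\lambda y.\,x\leftarrow[\![H]\!]_\eta[\mathbf{return}\,y];\mathbf{return}\,\{\lambda\_.[\![M']\!]_\eta\}\}$. **Theorem.** Let $C$ be an evaluation context of $\mathrm{DEL}_{one}$,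 $M$ a computation and $\theta$ a store of $\mathrm{DEL}_{one}$, and $D$ a configuration of $\mathrm{AC}$ such that $\langle C[M],\theta\rangle\sim D$. - If $\langle M,\theta\rangle$ takes a $\beta$-step to $\langle M',\theta'\rangle$, then there is a configuration $D'$ with $D\to_{AC}^{+}D'$ and $\langle C[M'],\theta'\rangle\sim D'$. - If $\langle M,\theta\rangle$ takes a $\beta$-step to $\bot$, then there is a configuration $D'$ with $D\to_{AC}^{+}D'$ and $\bot\sim D'$, that is, $D\to_{AC}^{+}\bot$. -/

import Mathlib

namespace DelToAC

/-! ### Common material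

Both calculi extend the multi-adjunctive metalanguage MAM (call-by-push-value without types).
Terms are represented with de Bruijn indices, so that equality of terms is
`α`-equivalence and substitution is capture avoiding. -/

/-- Continuation labels of `DEL_one` and coroutine labels of `AC`. -/
abbrev Label := ℕ

/-- Variant (sum constructor) labels. -/
abbrev Tag := ℕ

/-- The action of a renaming below one binder. -/
def liftR (ρ : ℕ → ℕ) : ℕ → ℕ
  | 0 => 0
  | n + 1 => ρ n + 1

/-- The assignment sending index `0` to `a` and index `n + 1` to `σ n`. -/
def scons {α : Type} (a : α) (σ : ℕ → α) : ℕ → α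
  | 0 => a
  | n + 1 => σ n

/-- The content of a store location: either `nil` or a stored object. -/
inductive Slot (α : Type) : Type
  | nil : Slot α
  | full : α → Slot α

/-- Domain of a partial function. -/
def pdom {α β : Type} (f : α → Option β) : Set α := {a | ∃ b, f a = some b}

/-- Image of a partial function. -/
def pim {α β : Type} (f : α → Option β) : Set β := {b | ∃ a, f a = some b}

/-! ### The calculus `DEL_one` -/

mutual
/-- Values of `DEL_one`. -/
inductive DVal : Type
  | var : ℕ → DVal
  | unit : DVal
  | lab : Label → DVal
  | pair : DVal → DVal → DVal
  | inj : Tag → DVal → DVal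
  | thunk : DComp → DVal
/-- Computations of `DEL_one`.
* `pcase V M` is `case V of (x₁, x₂) ↦ M`; in `M` index `1` is `x₁` and index `0` is `x₂`.
* `scase V B` is `case V of {inj_{L_i} x_i ↦ M_i}_i`; each `M_i` binds `x_i` as index `0`.
* `seq M N` is `x ← M; N` (also written `let x = M in N`); `N` binds `x`.
* `lam M` is `λx. M`; `cpair M N` is `⟨M, N⟩`.
* `shift M` is `shift k. M`; `M` binds `k`.
* `dollar M N` is the delimited computation `⟨M | x. N⟩`; `N` binds `x`.
* `throw V W` passes `W` to the continuation `V`. -/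
inductive DComp : Type
  | pcase : DVal → DComp → DComp
  | scase : DVal → DBrs → DComp
  | force : DVal → DComp
  | ret : DVal → DComp
  | seq : DComp → DComp → DComp
  | lam : DComp → DComp
  | app : DComp → DVal → DComp
  | cpair : DComp → DComp → DComp
  | prj : Fin 2 → DComp → DComp
  | shift : DComp → DComp
  | dollar : DComp → DComp → DComp
  | throw : DVal → DVal → DComp
/-- Finite families of branches `inj_{L_i} x_i ↦ M_i`. -/
inductive DBrs : Type
  | nil : DBrs
  | cons : Tag → DComp → DBrs → DBrs
end

mutual
/-- Renaming of variables. -/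
def DVal.ren (ρ : ℕ → ℕ) : DVal → DVal
  | .var n => .var (ρ n)
  | .unit => .unit
  | .lab l => .lab l
  | .pair V W => .pair (V.ren ρ) (W.ren ρ)
  | .inj L V => .inj L (V.ren ρ)
  | .thunk M => .thunk (M.ren ρ)
def DComp.ren (ρ : ℕ → ℕ) : DComp → DComp
  | .pcase V M => .pcase (V.ren ρ) (M.ren (liftR (liftR ρ)))
  | .scase V B => .scase (V.ren ρ) (B.ren ρ)
  | .force V => .force (V.ren ρ)
  | .ret V => .ret (V.ren ρ)
  | .seq M N => .seq (M.ren ρ) (N.ren (liftR ρ))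
  | .lam M => .lam (M.ren (liftR ρ))
  | .app M V => .app (M.ren ρ) (V.ren ρ)
  | .cpair M N => .cpair (M.ren ρ) (N.ren ρ)
  | .prj i M => .prj i (M.ren ρ)
  | .shift M => .shift (M.ren (liftR ρ))
  | .dollar M N => .dollar (M.ren ρ) (N.ren (liftR ρ))
  | .throw V W => .throw (V.ren ρ) (W.ren ρ)
def DBrs.ren (ρ : ℕ → ℕ) : DBrs → DBrs
  | .nil => .nil
  | .cons L M B => .cons L (M.ren (liftR ρ)) (B.ren ρ)
end

/-- The action of a substitution below one binder. -/
def DVal.up (σ : ℕ → DVal) : ℕ → DVal :=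
  scons (.var 0) (fun n => (σ n).ren Nat.succ)

mutual
/-- Simultaneous substitution. -/
def DVal.sub (σ : ℕ → DVal) : DVal → DVal
  | .var n => σ n
  | .unit => .unit
  | .lab l => .lab l
  | .pair V W => .pair (V.sub σ) (W.sub σ)
  | .inj L V => .inj L (V.sub σ)
  | .thunk M => .thunk (M.sub σ)
def DComp.sub (σ : ℕ → DVal) : DComp → DComp
  | .pcase V M => .pcase (V.sub σ) (M.sub (DVal.up (DVal.up σ)))
  | .scase V B => .scase (V.sub σ) (B.sub σ)
  | .force V => .force (V.sub σ)
  | .ret V => .ret (V.sub σ)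
  | .seq M N => .seq (M.sub σ) (N.sub (DVal.up σ))
  | .lam M => .lam (M.sub (DVal.up σ))
  | .app M V => .app (M.sub σ) (V.sub σ)
  | .cpair M N => .cpair (M.sub σ) (N.sub σ)
  | .prj i M => .prj i (M.sub σ)
  | .shift M => .shift (M.sub (DVal.up σ))
  | .dollar M N => .dollar (M.sub σ) (N.sub (DVal.up σ))
  | .throw V W => .throw (V.sub σ) (W.sub σ)
def DBrs.sub (σ : ℕ → DVal) : DBrs → DBrs
  | .nil => .nil
  | .cons L M B => .cons L (M.sub (DVal.up σ)) (B.sub σ)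
end

/-- `M[V/x]`, where `x` is index `0`. -/
def DComp.inst (M : DComp) (V : DVal) : DComp := M.sub (scons V DVal.var)

/-- `M[V₁/x₁, V₂/x₂]`, where `x₁` is index `1` and `x₂` is index `0`. -/
def DComp.inst2 (M : DComp) (V₁ V₂ : DVal) : DComp :=
  M.sub (scons V₂ (scons V₁ DVal.var))

/-- The branch of a case distinction that belongs to a tag. -/
def DBrs.find (L : Tag) : DBrs → Option DComp
  | .nil => none
  | .cons L' M B => if L' = L then some M else B.find L

mutual
/-- The set of continuation labels that occur in an expression. -/
def DVal.labels : DVal → Set Label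
  | .var _ => ∅
  | .unit => ∅
  | .lab l => {l}
  | .pair V W => V.labels ∪ W.labels
  | .inj _ V => V.labels
  | .thunk M => M.labels
def DComp.labels : DComp → Set Label
  | .pcase V M => V.labels ∪ M.labels
  | .scase V B => V.labels ∪ B.labels
  | .force V => V.labels
  | .ret V => V.labels
  | .seq M N => M.labels ∪ N.labels
  | .lam M => M.labels
  | .app M V => M.labels ∪ V.labels
  | .cpair M N => M.labels ∪ N.labels
  | .prj _ M => M.labels
  | .shift M => M.labels
  | .dollar M N => M.labels ∪ N.labels
  | .throw V W => V.labels ∪ W.labels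
def DBrs.labels : DBrs → Set Label
  | .nil => ∅
  | .cons _ M B => M.labels ∪ B.labels
end

/-- Pure contexts `H` of `DEL_one`; `seq H N` is `x ← H[ ]; N`, and so on. -/
inductive DPCtx : Type
  | hole : DPCtx
  | seq : DPCtx → DComp → DPCtx
  | app : DPCtx → DVal → DPCtx
  | prj : Fin 2 → DPCtx → DPCtx

/-- `H[M]`. -/
def DPCtx.plug : DPCtx → DComp → DComp
  | .hole, M => M
  | .seq H N, M => .seq (H.plug M) N
  | .app H V, M => .app (H.plug M) V
  | .prj i H, M => .prj i (H.plug M)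

/-- The set of continuation labels that occur in a pure context. -/
def DPCtx.labels : DPCtx → Set Label
  | .hole => ∅
  | .seq H N => H.labels ∪ N.labels
  | .app H V => H.labels ∪ V.labels
  | .prj _ H => H.labels

/-- Evaluation contexts `C` of `DEL_one`; `dollar C N` is `⟨C[ ] | x. N⟩`. -/
inductive DCtx : Type
  | hole : DCtx
  | seq : DCtx → DComp → DCtx
  | app : DCtx → DVal → DCtx
  | prj : Fin 2 → DCtx → DCtx
  | dollar : DCtx → DComp → DCtx

/-- `C[M]`. -/
def DCtx.plug : DCtx → DComp → DComp
  | .hole, M => M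
  | .seq C N, M => .seq (C.plug M) N
  | .app C V, M => .app (C.plug M) V
  | .prj i C, M => .prj i (C.plug M)
  | .dollar C N, M => .dollar (C.plug M) N

/-- Captured continuations: `⟨H, M⟩` stands for the abstraction `λy. ⟨H[return y] | x. M⟩` with
`y` not free in `H` and `M`; in `body` the variable `x` is index `0`. -/
structure DCont : Type where
  ctx : DPCtx
  body : DComp

/-- Stores of `DEL_one`: finite partial maps from continuation labels to captured continuations
or `nil`. -/
abbrev DStore := Finmap (fun _ : Label => Slot DCont)

/-- Configurations of `DEL_one`: the error state `⊥` or a pair of a computation and a store. -/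
inductive DConf : Type
  | bot : DConf
  | conf : DComp → DStore → DConf

/-- Put the computation of a configuration into a context; `⊥` stays `⊥`. -/
def DConf.inCtx (C : DCtx) : DConf → DConf
  | .bot => .bot
  | .conf M θ => .conf (C.plug M) θ

/-- The `β`-steps `⟨M, θ⟩ →β R` of `DEL_one` (not closed under contexts). A label is fresh when
it is not in the domain of the store. -/
inductive DBeta : DComp → DStore → DConf → Prop
  | pcase (V₁ V₂ : DVal) (M : DComp) (θ : DStore) :
      DBeta (.pcase (.pair V₁ V₂) M) θ (.conf (M.inst2 V₁ V₂) θ)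
  | scase (L : Tag) (V : DVal) (B : DBrs) (M : DComp) (θ : DStore) :
      B.find L = some M → DBeta (.scase (.inj L V) B) θ (.conf (M.inst V) θ)
  | force (M : DComp) (θ : DStore) :
      DBeta (.force (.thunk M)) θ (.conf M θ)
  | seq (V : DVal) (M : DComp) (θ : DStore) :
      DBeta (.seq (.ret V) M) θ (.conf (M.inst V) θ)
  | app (M : DComp) (V : DVal) (θ : DStore) :
      DBeta (.app (.lam M) V) θ (.conf (M.inst V) θ)
  | prj₁ (M N : DComp) (θ : DStore) :
      DBeta (.prj 0 (.cpair M N)) θ (.conf M θ)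
  | prj₂ (M N : DComp) (θ : DStore) :
      DBeta (.prj 1 (.cpair M N)) θ (.conf N θ)
  | ret (V : DVal) (M : DComp) (θ : DStore) :
      DBeta (.dollar (.ret V) M) θ (.conf (M.inst V) θ)
  | shift (H : DPCtx) (M N : DComp) (θ : DStore) (l : Label) :
      l ∉ θ →
      DBeta (.dollar (H.plug (.shift M)) N) θ
        (.conf (M.inst (.lab l)) (θ.insert l (.full ⟨H, N⟩)))
  | throw (l : Label) (V : DVal) (H : DPCtx) (N : DComp) (θ : DStore) :
      θ.lookup l = some (.full ⟨H, N⟩) →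
      DBeta (.throw (.lab l) V) θ
        (.conf (.dollar (H.plug (.ret V)) N) (θ.insert l .nil))
  | fail (l : Label) (V : DVal) (θ : DStore) :
      θ.lookup l = some .nil → DBeta (.throw (.lab l) V) θ .bot

/-! ### The calculus `AC` of asymmetric coroutines -/

mutual
/-- Values of `AC`. -/
inductive AVal : Type
  | var : ℕ → AVal
  | unit : AVal
  | lab : Label → AVal
  | pair : AVal → AVal → AVal
  | inj : Tag → AVal → AVal
  | thunk : AComp → AVal
/-- Computations of `AC`; the constructors shared with `DEL_one` are as there, and
`label l M` is the labelled computation `l : M`, in which the coroutine `l` is active. -/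
inductive AComp : Type
  | pcase : AVal → AComp → AComp
  | scase : AVal → ABrs → AComp
  | force : AVal → AComp
  | ret : AVal → AComp
  | seq : AComp → AComp → AComp
  | lam : AComp → AComp
  | app : AComp → AVal → AComp
  | cpair : AComp → AComp → AComp
  | prj : Fin 2 → AComp → AComp
  | label : Label → AComp → AComp
  | create : AVal → AComp
  | resume : AVal → AVal → AComp
  | yield : AVal → AComp
/-- Finite families of branches. -/
inductive ABrs : Type
  | nil : ABrs
  | cons : Tag → AComp → ABrs → ABrs
end

mutual
/-- Renaming of variables. -/
def AVal.ren (ρ : ℕ → ℕ) : AVal → AVal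
  | .var n => .var (ρ n)
  | .unit => .unit
  | .lab l => .lab l
  | .pair V W => .pair (V.ren ρ) (W.ren ρ)
  | .inj L V => .inj L (V.ren ρ)
  | .thunk M => .thunk (M.ren ρ)
def AComp.ren (ρ : ℕ → ℕ) : AComp → AComp
  | .pcase V M => .pcase (V.ren ρ) (M.ren (liftR (liftR ρ)))
  | .scase V B => .scase (V.ren ρ) (B.ren ρ)
  | .force V => .force (V.ren ρ)
  | .ret V => .ret (V.ren ρ)
  | .seq M N => .seq (M.ren ρ) (N.ren (liftR ρ))
  | .lam M => .lam (M.ren (liftR ρ))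
  | .app M V => .app (M.ren ρ) (V.ren ρ)
  | .cpair M N => .cpair (M.ren ρ) (N.ren ρ)
  | .prj i M => .prj i (M.ren ρ)
  | .label l M => .label l (M.ren ρ)
  | .create V => .create (V.ren ρ)
  | .resume V W => .resume (V.ren ρ) (W.ren ρ)
  | .yield V => .yield (V.ren ρ)
def ABrs.ren (ρ : ℕ → ℕ) : ABrs → ABrs
  | .nil => .nil
  | .cons L M B => .cons L (M.ren (liftR ρ)) (B.ren ρ)
end

/-- The action of a substitution below one binder. -/
def AVal.up (σ : ℕ → AVal) : ℕ → AVal :=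
  scons (.var 0) (fun n => (σ n).ren Nat.succ)

mutual
/-- Simultaneous substitution. -/
def AVal.sub (σ : ℕ → AVal) : AVal → AVal
  | .var n => σ n
  | .unit => .unit
  | .lab l => .lab l
  | .pair V W => .pair (V.sub σ) (W.sub σ)
  | .inj L V => .inj L (V.sub σ)
  | .thunk M => .thunk (M.sub σ)
def AComp.sub (σ : ℕ → AVal) : AComp → AComp
  | .pcase V M => .pcase (V.sub σ) (M.sub (AVal.up (AVal.up σ)))
  | .scase V B => .scase (V.sub σ) (B.sub σ)
  | .force V => .force (V.sub σ)
  | .ret V => .ret (V.sub σ)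
  | .seq M N => .seq (M.sub σ) (N.sub (AVal.up σ))
  | .lam M => .lam (M.sub (AVal.up σ))
  | .app M V => .app (M.sub σ) (V.sub σ)
  | .cpair M N => .cpair (M.sub σ) (N.sub σ)
  | .prj i M => .prj i (M.sub σ)
  | .label l M => .label l (M.sub σ)
  | .create V => .create (V.sub σ)
  | .resume V W => .resume (V.sub σ) (W.sub σ)
  | .yield V => .yield (V.sub σ)
def ABrs.sub (σ : ℕ → AVal) : ABrs → ABrs
  | .nil => .nil
  | .cons L M B => .cons L (M.sub (AVal.up σ)) (B.sub σ)
end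

/-- `M[V/x]`, where `x` is index `0`. -/
def AComp.inst (M : AComp) (V : AVal) : AComp := M.sub (scons V AVal.var)

/-- `M[V₁/x₁, V₂/x₂]`, where `x₁` is index `1` and `x₂` is index `0`. -/
def AComp.inst2 (M : AComp) (V₁ V₂ : AVal) : AComp :=
  M.sub (scons V₂ (scons V₁ AVal.var))

/-- The branch of a case distinction that belongs to a tag. -/
def ABrs.find (L : Tag) : ABrs → Option AComp
  | .nil => none
  | .cons L' M B => if L' = L then some M else B.find L

mutual
/-- The set of active labels of an expression: all `l` for which a labelled computation `l : M`
occurs in it. -/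
def AVal.active : AVal → Set Label
  | .var _ => ∅
  | .unit => ∅
  | .lab _ => ∅
  | .pair V W => V.active ∪ W.active
  | .inj _ V => V.active
  | .thunk M => M.active
def AComp.active : AComp → Set Label
  | .pcase V M => V.active ∪ M.active
  | .scase V B => V.active ∪ B.active
  | .force V => V.active
  | .ret V => V.active
  | .seq M N => M.active ∪ N.active
  | .lam M => M.active
  | .app M V => M.active ∪ V.active
  | .cpair M N => M.active ∪ N.active
  | .prj _ M => M.active
  | .label l M => {l} ∪ M.active
  | .create V => V.active
  | .resume V W => V.active ∪ W.active
  | .yield V => V.active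
def ABrs.active : ABrs → Set Label
  | .nil => ∅
  | .cons _ M B => M.active ∪ B.active
end

/-- Pure contexts of `AC`. -/
inductive APCtx : Type
  | hole : APCtx
  | seq : APCtx → AComp → APCtx
  | app : APCtx → AVal → APCtx
  | prj : Fin 2 → APCtx → APCtx

/-- `H[M]`. -/
def APCtx.plug : APCtx → AComp → AComp
  | .hole, M => M
  | .seq H N, M => .seq (H.plug M) N
  | .app H V, M => .app (H.plug M) V
  | .prj i H, M => .prj i (H.plug M)

/-- Renaming of variables in a pure context. -/
def APCtx.ren (ρ : ℕ → ℕ) : APCtx → APCtx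
  | .hole => .hole
  | .seq H N => .seq (H.ren ρ) (N.ren (liftR ρ))
  | .app H V => .app (H.ren ρ) (V.ren ρ)
  | .prj i H => .prj i (H.ren ρ)

/-- The value `{λy. H[return y]}` with `y` not free in `H`. -/
def APCtx.reify (H : APCtx) : AVal :=
  .thunk (.lam ((H.ren Nat.succ).plug (.ret (.var 0))))

/-- Evaluation contexts of `AC`; `label l D` is `l : D[ ]`. -/
inductive ACtx : Type
  | hole : ACtx
  | seq : ACtx → AComp → ACtx
  | app : ACtx → AVal → ACtx
  | prj : Fin 2 → ACtx → ACtx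
  | label : Label → ACtx → ACtx

/-- `D[M]`. -/
def ACtx.plug : ACtx → AComp → AComp
  | .hole, M => M
  | .seq D N, M => .seq (D.plug M) N
  | .app D V, M => .app (D.plug M) V
  | .prj i D, M => .prj i (D.plug M)
  | .label l D, M => .label l (D.plug M)

/-- Stores of `AC`: finite partial maps from coroutine labels to values or `nil`. -/
abbrev AStore := Finmap (fun _ : Label => Slot AVal)

/-- Configurations of `AC`. -/
inductive AConf : Type
  | bot : AConf
  | conf : AComp → AStore → AConf

/-- Put the computation of a configuration into a context; `⊥` stays `⊥`. -/
def AConf.inCtx (D : ACtx) : AConf → AConf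
  | .bot => .bot
  | .conf N τ => .conf (D.plug N) τ

/-- The `β`-steps of `AC` (not closed under contexts). -/
inductive ABeta : AComp → AStore → AConf → Prop
  | pcase (V₁ V₂ : AVal) (M : AComp) (τ : AStore) :
      ABeta (.pcase (.pair V₁ V₂) M) τ (.conf (M.inst2 V₁ V₂) τ)
  | scase (L : Tag) (V : AVal) (B : ABrs) (M : AComp) (τ : AStore) :
      B.find L = some M → ABeta (.scase (.inj L V) B) τ (.conf (M.inst V) τ)
  | force (M : AComp) (τ : AStore) :
      ABeta (.force (.thunk M)) τ (.conf M τ)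
  | seq (V : AVal) (M : AComp) (τ : AStore) :
      ABeta (.seq (.ret V) M) τ (.conf (M.inst V) τ)
  | app (M : AComp) (V : AVal) (τ : AStore) :
      ABeta (.app (.lam M) V) τ (.conf (M.inst V) τ)
  | prj₁ (M N : AComp) (τ : AStore) :
      ABeta (.prj 0 (.cpair M N)) τ (.conf M τ)
  | prj₂ (M N : AComp) (τ : AStore) :
      ABeta (.prj 1 (.cpair M N)) τ (.conf N τ)
  | create (V : AVal) (τ : AStore) (l : Label) :
      l ∉ τ → ABeta (.create V) τ (.conf (.ret (.lab l)) (τ.insert l (.full V)))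
  | resume (l : Label) (V W : AVal) (τ : AStore) :
      τ.lookup l = some (.full V) →
      ABeta (.resume (.lab l) W) τ
        (.conf (.label l (.app (.force V) W)) (τ.insert l .nil))
  | fail (l : Label) (W : AVal) (τ : AStore) :
      τ.lookup l = some .nil → ABeta (.resume (.lab l) W) τ .bot
  | ret (l : Label) (V : AVal) (τ : AStore) :
      ABeta (.label l (.ret V)) τ (.conf (.ret V) τ)
  | yield (l : Label) (H : APCtx) (V : AVal) (τ : AStore) :
      ABeta (.label l (H.plug (.yield V))) τ
        (.conf (.ret V) (τ.insert l (.full H.reify)))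

/-- The reduction relation of `AC`: `β`-steps in evaluation contexts. -/
inductive AStep : AConf → AConf → Prop
  | mk (D : ACtx) (N : AComp) (τ : AStore) (R : AConf) :
      ABeta N τ R → AStep (.conf (D.plug N) τ) (R.inCtx D)

/-- Well-formedness of `AC`-computations. -/
inductive AComp.WF : AComp → Prop
  | pcase {V : AVal} {M : AComp} : V.active ∪ M.active = ∅ → AComp.WF (.pcase V M)
  | scase {V : AVal} {B : ABrs} : V.active ∪ B.active = ∅ → AComp.WF (.scase V B)
  | force {V : AVal} : V.active = ∅ → AComp.WF (.force V)
  | ret {V : AVal} : V.active = ∅ → AComp.WF (.ret V)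
  | seq {M N : AComp} : AComp.WF M → N.active = ∅ → AComp.WF (.seq M N)
  | lam {M : AComp} : M.active = ∅ → AComp.WF (.lam M)
  | app {M : AComp} {V : AVal} : AComp.WF M → V.active = ∅ → AComp.WF (.app M V)
  | cpair {M N : AComp} : M.active ∪ N.active = ∅ → AComp.WF (.cpair M N)
  | prj {i : Fin 2} {M : AComp} : AComp.WF M → AComp.WF (.prj i M)
  | label {l : Label} {M : AComp} : AComp.WF M → l ∉ M.active → AComp.WF (.label l M)
  | create {V : AVal} : V.active = ∅ → AComp.WF (.create V)
  | resume {V W : AVal} : V.active ∪ W.active = ∅ → AComp.WF (.resume V W)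
  | yield {V : AVal} : V.active = ∅ → AComp.WF (.yield V)

/-- Well-formedness of the configuration `⟨N, τ⟩`. -/
structure WellFormed (N : AComp) (τ : AStore) : Prop where
  comp : N.WF
  store : ∀ l V, τ.lookup l = some (.full V) → V.active = ∅
  active_nil : ∀ l ∈ N.active, τ.lookup l = some .nil

/-! ### Auxiliary `AC`-programs: numerals, reference cells, failure -/

def tagZero : Tag := 0
def tagSucc : Tag := 1
def tagTrue : Tag := 2
def tagFalse : Tag := 3
def tagGet : Tag := 4
def tagSet : Tag := 5

/-- Unary numerals: `inj_Zero ()` and `inj_Succ n`. -/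
def num : ℕ → AVal
  | 0 => .inj tagZero .unit
  | n + 1 => .inj tagSucc (num n)

/-- `incr = {λn. return (inj_Succ n)}`. -/
def incrV : AVal := .thunk (.lam (.ret (.inj tagSucc (.var 0))))

/-- `{λf. λa. λb. case a of {Zero _ ↦ case b of {Zero _ ↦ return True; Succ _ ↦ return False};`
`Succ a₁ ↦ case b of {Zero _ ↦ return False; Succ b₁ ↦ f! f a₁ b₁}}}`. -/
def compareStep : AVal :=
  .thunk (.lam (.lam (.lam (.scase (.var 1)
    (.cons tagZero
      (.scase (.var 1)
        (.cons tagZero (.ret (.inj tagTrue .unit))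
        (.cons tagSucc (.ret (.inj tagFalse .unit)) .nil)))
    (.cons tagSucc
      (.scase (.var 1)
        (.cons tagZero (.ret (.inj tagFalse .unit))
        (.cons tagSucc
          (.app (.app (.app (.force (.var 4)) (.var 4)) (.var 1)) (.var 0)) .nil)))
    .nil))))))

/-- Equality test of numerals, by self-application. -/
def compareV : AVal := .thunk (.app (.force compareStep) compareStep)

/-- The body of a reference cell:
`{λf. λs. λc. case c of {Get _ ↦ c₁ ← yield s; f! f s c₁; Set t ↦ c₁ ← yield (); f! f t c₁}}`. -/
def cellStep : AVal :=
  .thunk (.lam (.lam (.lam (.scase (.var 0)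
    (.cons tagGet
      (.seq (.yield (.var 2))
        (.app (.app (.app (.force (.var 4)) (.var 4)) (.var 3)) (.var 0)))
    (.cons tagSet
      (.seq (.yield .unit)
        (.app (.app (.app (.force (.var 4)) (.var 4)) (.var 1)) (.var 0)))
    .nil))))))

/-- The coroutine `{λy. c ← return y; cellStep! cellStep V c}`, which represents a reference cell
with content `V`. -/
def refCell (V : AVal) : AVal :=
  .thunk (.lam (.seq (.ret (.var 0))
    (.app (.app (.app (.force cellStep) cellStep) (V.ren (fun n => n + 2))) (.var 0))))

/-- `ref = {λv. create (refCell v)}`. -/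
def refV : AVal := .thunk (.lam (.create (refCell (.var 0))))

/-- `get = {λr. resume r (inj_Get ())}`. -/
def getV : AVal := .thunk (.lam (.resume (.var 0) (.inj tagGet .unit)))

/-- `set = {λr. λv. resume r (inj_Set v)}`. -/
def setV : AVal := .thunk (.lam (.lam (.resume (.var 1) (.inj tagSet (.var 0)))))

/-- `fail` resumes a coroutine that has already finished:
`{z ← create {λ_. return ()}; _ ← resume z (); resume z ()}`. -/
def failV : AVal :=
  .thunk (.seq (.create (.thunk (.lam (.ret .unit))))
    (.seq (.resume (.var 0) .unit) (.resume (.var 1) .unit)))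

/-! ### The macro-translation -/

/-- Partial maps `η` from continuation labels to triples `(z, zc, i)`: a coroutine, its counter
reference, and a number. -/
abbrev Env := Label → Option (Label × Label × ℕ)

/-- The value `((z, zc), i)`. -/
def triple (t : Label × Label × ℕ) : AVal :=
  .pair (.pair (.lab t.1) (.lab t.2.1)) (num t.2.2)

/-- `x ← N₁; return {λ_. N₂}`, where `x` is index `0` of `N₂` (and `_` is not used). -/
def coBody (N₁ N₂ : AComp) : AComp :=
  .seq N₁ (.ret (.thunk (.lam (N₂.ren Nat.succ))))

/-- `let z = create {λ_. x ← N₁; return {λ_. N₂}} in let zc = ref! Zero in`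
`let res = resume z () in res! ((z, zc), Zero)`. -/
def dollarMacro (N₁ N₂ : AComp) : AComp :=
  .seq (.create (.thunk (.lam ((coBody N₁ N₂).ren Nat.succ))))
    (.seq (.app (.force refV) (num 0))
      (.seq (.resume (.var 1) .unit)
        (.app (.force (.var 0)) (.pair (.pair (.var 2) (.var 1)) (num 0)))))

/-- `case V of ((z, zc), i) ↦ let j = get! zc in let b = compare! i j in`
`case b of {True _ ↦ let i₁ = incr! i in let _ = set! zc i₁ in let res = resume z W in`
`res! ((z, zc), i₁); False _ ↦ fail!}`.
The bound variables are, from the outside in, `(z, zc)`, `i`, `z`, `zc`, `j`, `b`, `_`, `i₁`,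
`_`, `res`. -/
def throwMacro (V W : AVal) : AComp :=
  .pcase V (.pcase (.var 1)
    (.seq (.app (.force getV) (.var 0))
      (.seq (.app (.app (.force compareV) (.var 3)) (.var 0))
        (.scase (.var 0)
          (.cons tagTrue
            (.seq (.app (.force incrV) (.var 5))
              (.seq (.app (.app (.force setV) (.var 4)) (.var 0))
                (.seq (.resume (.var 6) (W.ren (fun n => n + 9)))
                  (.app (.force (.var 0))
                    (.pair (.pair (.var 7) (.var 6)) (.var 2))))))
          (.cons tagFalse (.force failV) .nil))))))

mutual
/-- The macro-translation `⟦·⟧_η`. As `η` is partial, `⟦E⟧_η` is defined only when all labels of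
`E` are in the domain of `η`; this is always required where the translation is used below, and
the value at other labels is irrelevant. -/
def DVal.tr (η : Env) : DVal → AVal
  | .var n => .var n
  | .unit => .unit
  | .lab l => match η l with
    | some t => triple t
    | none => .unit
  | .pair V W => .pair (V.tr η) (W.tr η)
  | .inj L V => .inj L (V.tr η)
  | .thunk M => .thunk (M.tr η)
def DComp.tr (η : Env) : DComp → AComp
  | .pcase V M => .pcase (V.tr η) (M.tr η)
  | .scase V B => .scase (V.tr η) (B.tr η)
  | .force V => .force (V.tr η)
  | .ret V => .ret (V.tr η)
  | .seq M N => .seq (M.tr η) (N.tr η)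
  | .lam M => .lam (M.tr η)
  | .app M V => .app (M.tr η) (V.tr η)
  | .cpair M N => .cpair (M.tr η) (N.tr η)
  | .prj i M => .prj i (M.tr η)
  | .shift M => .yield (.thunk (.lam (M.tr η)))
  | .dollar M N => dollarMacro (M.tr η) (N.tr η)
  | .throw V W => throwMacro (V.tr η) (W.tr η)
def DBrs.tr (η : Env) : DBrs → ABrs
  | .nil => .nil
  | .cons L M B => .cons L (M.tr η) (B.tr η)
end

/-- The translation of pure contexts. -/
def DPCtx.tr (η : Env) : DPCtx → APCtx
  | .hole => .hole
  | .seq H N => .seq (H.tr η) (N.tr η)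
  | .app H V => .app (H.tr η) (V.tr η)
  | .prj i H => .prj i (H.tr η)

/-- `⟦V⟧_η` is defined and equal to `W`. -/
def TrVal (η : Env) (V : DVal) (W : AVal) : Prop := V.labels ⊆ pdom η ∧ W = V.tr η

/-- `⟦M⟧_η` is defined and equal to `N`. -/
def TrComp (η : Env) (M : DComp) (N : AComp) : Prop := M.labels ⊆ pdom η ∧ N = M.tr η

/-- `⟦H⟧_η` is defined and equal to `K`. -/
def TrPCtx (η : Env) (H : DPCtx) (K : APCtx) : Prop := H.labels ⊆ pdom η ∧ K = H.tr η

/-! ### The simulation relation -/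

/-- `getnum l τ = i`: the coroutine `l` is a reference cell with content `i`. -/
def GetNum (l : Label) (τ : AStore) (i : ℕ) : Prop :=
  τ.lookup l = some (.full (refCell (num i)))

/-- `let res = m : (x ← N₁; return {λ_. N₂}) in res! ((m, mc), i)`. -/
def running (m mc : Label) (i : ℕ) (N₁ N₂ : AComp) : AComp :=
  .seq (.label m (coBody N₁ N₂)) (.app (.force (.var 0)) (triple (m, mc, i)))

/-- `Rel η κ θ τ M N` is the relation `⟨M, θ⟩ ~_{η,κ} ⟨N, τ⟩`. -/
inductive Rel (η : Env) (κ : Label → Option Label) (θ : DStore) (τ : AStore) :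
    DComp → AComp → Prop
  | pcase {V : DVal} {M : DComp} {N : AComp} :
      TrComp η (.pcase V M) N → Rel η κ θ τ (.pcase V M) N
  | scase {V : DVal} {B : DBrs} {N : AComp} :
      TrComp η (.scase V B) N → Rel η κ θ τ (.scase V B) N
  | force {V : DVal} {N : AComp} :
      TrComp η (.force V) N → Rel η κ θ τ (.force V) N
  | ret {V : DVal} {N : AComp} :
      TrComp η (.ret V) N → Rel η κ θ τ (.ret V) N
  | lam {M : DComp} {N : AComp} :
      TrComp η (.lam M) N → Rel η κ θ τ (.lam M) N
  | cpair {M₁ M₂ : DComp} {N : AComp} :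
      TrComp η (.cpair M₁ M₂) N → Rel η κ θ τ (.cpair M₁ M₂) N
  | shift {M : DComp} {N : AComp} :
      TrComp η (.shift M) N → Rel η κ θ τ (.shift M) N
  | dollar {M₁ M₂ : DComp} {N : AComp} :
      TrComp η (.dollar M₁ M₂) N → Rel η κ θ τ (.dollar M₁ M₂) N
  | throw {V W : DVal} {N : AComp} :
      TrComp η (.throw V W) N → Rel η κ θ τ (.throw V W) N
  | seq {M₁ M₂ : DComp} {N₁ N₂ : AComp} :
      Rel η κ θ τ M₁ N₁ → TrComp η M₂ N₂ → Rel η κ θ τ (.seq M₁ M₂) (.seq N₁ N₂)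
  | app {M : DComp} {V : DVal} {N : AComp} {W : AVal} :
      Rel η κ θ τ M N → TrVal η V W → Rel η κ θ τ (.app M V) (.app N W)
  | prj {i : Fin 2} {M : DComp} {N : AComp} :
      Rel η κ θ τ M N → Rel η κ θ τ (.prj i M) (.prj i N)
  | running {M₁ M₂ : DComp} {N₁ N₂ : AComp} {m mc : Label} {i : ℕ} :
      Rel η κ θ τ M₁ N₁ → TrComp η M₂ N₂ →
      κ m = some mc → GetNum mc τ i → τ.lookup m = some .nil →
      (∀ l j, η l = some (m, mc, j) → θ.lookup l = some .nil) →
      Rel η κ θ τ (.dollar M₁ M₂) (running m mc i N₁ N₂)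

/-- The invariant conditions on `θ`, `τ`, `η` and `κ`. -/
structure IC (θ : DStore) (τ : AStore) (η : Env) (κ : Label → Option Label) : Prop where
  kappa_inj : ∀ m m' c, κ m = some c → κ m' = some c → m = m'
  kappa_disjoint : pdom κ ∩ pim κ = ∅
  kappa_dom : pdom κ ∪ pim κ = {l | l ∈ τ}
  eta_dom : pdom η = {l | l ∈ θ}
  eta_kappa : ∀ l z zc i, η l = some (z, zc, i) → κ z = some zc
  used : ∀ l z zc i, η l = some (z, zc, i) → θ.lookup l = some .nil →
    ∃ j, GetNum zc τ j ∧ i < j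
  live : ∀ l z zc i H M, η l = some (z, zc, i) → θ.lookup l = some (.full ⟨H, M⟩) →
    l ∉ M.labels ∧
    GetNum zc τ i ∧
    (∀ l' ∈ θ, l' ≠ l → ∀ zc' i', η l' = some (z, zc', i') → θ.lookup l' = some .nil) ∧
    ∃ K N, TrPCtx η H K ∧ TrComp η M N ∧
      τ.lookup z = some
        (.full (APCtx.seq K (.ret (.thunk (.lam (N.ren Nat.succ))))).reify)

/-- The simulation relation `C ~ D`. -/
def Sim (C : DConf) (D : AConf) : Prop :=
  (C = .bot ∧ D = .bot) ∨
  ∃ (M : DComp) (N : AComp) (θ : DStore) (τ : AStore) (η : Env) (κ : Label → Option Label),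
    C = .conf M θ ∧ D = .conf N τ ∧ Rel η κ θ τ M N ∧ WellFormed N τ ∧ IC θ τ η κ

end DelToAC

open DelToAC

namespace DelToAC

/-! ### Substitution in `AC` -/

-- A delimiter is played by a coroutine that runs the delimited computation and then returns the
-- code after the delimiter as a thunk. Finishing and yielding leave the coroutine in the same way:
-- a function comes out and is applied to the name `((z, zc), i)`. After a normal return this
-- function ignores the name (`running_ret`); after a `shift` it is the shift body, and the name
-- becomes the continuation variable (`running_yield`). The frame that wraps the code after the
-- delimiter is pure, so the value stored by the yield contains both the captured context and that
-- code, exactly as `IC.live` demands. Resuming it rebuilds the delimiter (`throwMacro_run`).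
--
-- One coroutine serves several successive captures, so a name carries the value that the counter
-- had at capture time. Each throw increments the counter. The number of a spent continuation
-- therefore stays strictly below the counter, the comparison fails, and `failV` reaches `⊥`
-- (`throwMacro_fail`). `IC.create`, `IC.throw` and `IC.capture` show that the three kinds of store
-- change preserve this bookkeeping.
--
-- The target may lag behind: a delimiter around the redex may still be an unexecuted macro, with
-- everything below it merely translated. `Rel.decompose` runs such macros from the outside in,
-- which changes only `κ` and the target store, until `CtxRel` holds for the whole context. The
-- label set of `CtxRel` records the running coroutines, which are pairwise distinct; hence a store
-- change at one of them does not disturb the frames of the others (`CtxRel.mono`). For the redexes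
-- whose head is a delimiter, this delimiter is counted as part of the context, so that it too is
-- forced to run.
--
-- What remains is local. The translation commutes with substitution (`DComp.tr_inst`,
-- `DComp.tr_inst2`), so common steps are matched directly; the other steps are matched by running
-- the macros. `CtxRel.sim` then reassembles a similar pair of configurations.

@[simp] theorem liftR_zero (ρ : ℕ → ℕ) : liftR ρ 0 = 0 := rfl
@[simp] theorem scons_zero {α : Type} (a : α) (σ : ℕ → α) : scons a σ 0 = a := rfl
@[simp] theorem scons_succ {α : Type} (a : α) (σ : ℕ → α) (n : ℕ) :
    scons a σ (n + 1) = σ n := rfl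
@[simp] theorem AVal.up_zero (σ : ℕ → AVal) : AVal.up σ 0 = .var 0 := rfl
@[simp] theorem AVal.up_succ (σ : ℕ → AVal) (n : ℕ) :
    AVal.up σ (n + 1) = (σ n).ren Nat.succ := rfl

theorem liftR_comp (ρ ρ' : ℕ → ℕ) :
    (fun n => liftR ρ' (liftR ρ n)) = liftR (fun n => ρ' (ρ n)) := by
  funext n; cases n <;> rfl

mutual
theorem AVal.ren_ren (ρ ρ' : ℕ → ℕ) :
    ∀ V : AVal, (V.ren ρ).ren ρ' = V.ren (fun n => ρ' (ρ n))
  | .var _ => rfl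
  | .unit => rfl
  | .lab _ => rfl
  | .pair V W => by simp only [AVal.ren, AVal.ren_ren ρ ρ' V, AVal.ren_ren ρ ρ' W]
  | .inj _ V => by simp only [AVal.ren, AVal.ren_ren ρ ρ' V]
  | .thunk M => by simp only [AVal.ren, AComp.ren_ren ρ ρ' M]
theorem AComp.ren_ren (ρ ρ' : ℕ → ℕ) :
    ∀ M : AComp, (M.ren ρ).ren ρ' = M.ren (fun n => ρ' (ρ n))
  | .pcase V M => by
    simp only [AComp.ren, AVal.ren_ren ρ ρ' V, AComp.ren_ren _ _ M, liftR_comp]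
  | .scase V B => by simp only [AComp.ren, AVal.ren_ren ρ ρ' V, ABrs.ren_ren ρ ρ' B]
  | .force V => by simp only [AComp.ren, AVal.ren_ren ρ ρ' V]
  | .ret V => by simp only [AComp.ren, AVal.ren_ren ρ ρ' V]
  | .seq M N => by simp only [AComp.ren, AComp.ren_ren _ _ M, AComp.ren_ren _ _ N, liftR_comp]
  | .lam M => by simp only [AComp.ren, AComp.ren_ren _ _ M, liftR_comp]
  | .app M V => by simp only [AComp.ren, AComp.ren_ren _ _ M, AVal.ren_ren ρ ρ' V]
  | .cpair M N => by simp only [AComp.ren, AComp.ren_ren _ _ M, AComp.ren_ren _ _ N]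
  | .prj _ M => by simp only [AComp.ren, AComp.ren_ren _ _ M]
  | .label _ M => by simp only [AComp.ren, AComp.ren_ren _ _ M]
  | .create V => by simp only [AComp.ren, AVal.ren_ren ρ ρ' V]
  | .resume V W => by simp only [AComp.ren, AVal.ren_ren ρ ρ' V, AVal.ren_ren ρ ρ' W]
  | .yield V => by simp only [AComp.ren, AVal.ren_ren ρ ρ' V]
theorem ABrs.ren_ren (ρ ρ' : ℕ → ℕ) :
    ∀ B : ABrs, (B.ren ρ).ren ρ' = B.ren (fun n => ρ' (ρ n))
  | .nil => rfl
  | .cons _ M B => by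
    simp only [ABrs.ren, AComp.ren_ren _ _ M, ABrs.ren_ren ρ ρ' B, liftR_comp]
end

theorem AVal.up_liftR (ρ : ℕ → ℕ) (σ : ℕ → AVal) :
    (fun n => AVal.up σ (liftR ρ n)) = AVal.up (fun n => σ (ρ n)) := by
  funext n; cases n <;> rfl

mutual
theorem AVal.ren_sub (ρ : ℕ → ℕ) (σ : ℕ → AVal) :
    ∀ V : AVal, (V.ren ρ).sub σ = V.sub (fun n => σ (ρ n))
  | .var _ => rfl
  | .unit => rfl
  | .lab _ => rfl
  | .pair V W => by simp only [AVal.ren, AVal.sub, AVal.ren_sub ρ σ V, AVal.ren_sub ρ σ W]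
  | .inj _ V => by simp only [AVal.ren, AVal.sub, AVal.ren_sub ρ σ V]
  | .thunk M => by simp only [AVal.ren, AVal.sub, AComp.ren_sub ρ σ M]
theorem AComp.ren_sub (ρ : ℕ → ℕ) (σ : ℕ → AVal) :
    ∀ M : AComp, (M.ren ρ).sub σ = M.sub (fun n => σ (ρ n))
  | .pcase V M => by
    simp only [AComp.ren, AComp.sub, AVal.ren_sub ρ σ V, AComp.ren_sub _ _ M, AVal.up_liftR]
  | .scase V B => by simp only [AComp.ren, AComp.sub, AVal.ren_sub ρ σ V, ABrs.ren_sub ρ σ B]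
  | .force V => by simp only [AComp.ren, AComp.sub, AVal.ren_sub ρ σ V]
  | .ret V => by simp only [AComp.ren, AComp.sub, AVal.ren_sub ρ σ V]
  | .seq M N => by
    simp only [AComp.ren, AComp.sub, AComp.ren_sub _ _ M, AComp.ren_sub _ _ N, AVal.up_liftR]
  | .lam M => by simp only [AComp.ren, AComp.sub, AComp.ren_sub _ _ M, AVal.up_liftR]
  | .app M V => by simp only [AComp.ren, AComp.sub, AComp.ren_sub _ _ M, AVal.ren_sub ρ σ V]
  | .cpair M N => by simp only [AComp.ren, AComp.sub, AComp.ren_sub _ _ M, AComp.ren_sub _ _ N]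
  | .prj _ M => by simp only [AComp.ren, AComp.sub, AComp.ren_sub _ _ M]
  | .label _ M => by simp only [AComp.ren, AComp.sub, AComp.ren_sub _ _ M]
  | .create V => by simp only [AComp.ren, AComp.sub, AVal.ren_sub ρ σ V]
  | .resume V W => by
    simp only [AComp.ren, AComp.sub, AVal.ren_sub ρ σ V, AVal.ren_sub ρ σ W]
  | .yield V => by simp only [AComp.ren, AComp.sub, AVal.ren_sub ρ σ V]
theorem ABrs.ren_sub (ρ : ℕ → ℕ) (σ : ℕ → AVal) :
    ∀ B : ABrs, (B.ren ρ).sub σ = B.sub (fun n => σ (ρ n))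
  | .nil => rfl
  | .cons _ M B => by
    simp only [ABrs.ren, ABrs.sub, AComp.ren_sub _ _ M, ABrs.ren_sub ρ σ B, AVal.up_liftR]
end

/-- Needed to push a renaming through a substitution below a binder. The successor case swaps two
renamings, hence the dependence on `AVal.ren_ren`. The composition of two substitutions is never
needed: the macros only weaken their arguments, and the translation is commuted with one
substitution at a time. -/
theorem AVal.liftR_up (ρ : ℕ → ℕ) (σ : ℕ → AVal) :
    (fun n => (AVal.up σ n).ren (liftR ρ)) = AVal.up (fun n => (σ n).ren ρ) := by
  funext n
  cases n with
  | zero => rfl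
  | succ n => simp only [AVal.up_succ, AVal.ren_ren]; rfl

mutual
theorem AVal.sub_ren (ρ : ℕ → ℕ) (σ : ℕ → AVal) :
    ∀ V : AVal, (V.sub σ).ren ρ = V.sub (fun n => (σ n).ren ρ)
  | .var _ => rfl
  | .unit => rfl
  | .lab _ => rfl
  | .pair V W => by simp only [AVal.ren, AVal.sub, AVal.sub_ren ρ σ V, AVal.sub_ren ρ σ W]
  | .inj _ V => by simp only [AVal.ren, AVal.sub, AVal.sub_ren ρ σ V]
  | .thunk M => by simp only [AVal.ren, AVal.sub, AComp.sub_ren ρ σ M]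
theorem AComp.sub_ren (ρ : ℕ → ℕ) (σ : ℕ → AVal) :
    ∀ M : AComp, (M.sub σ).ren ρ = M.sub (fun n => (σ n).ren ρ)
  | .pcase V M => by
    simp only [AComp.ren, AComp.sub, AVal.sub_ren ρ σ V, AComp.sub_ren _ _ M, AVal.liftR_up]
  | .scase V B => by simp only [AComp.ren, AComp.sub, AVal.sub_ren ρ σ V, ABrs.sub_ren ρ σ B]
  | .force V => by simp only [AComp.ren, AComp.sub, AVal.sub_ren ρ σ V]
  | .ret V => by simp only [AComp.ren, AComp.sub, AVal.sub_ren ρ σ V]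
  | .seq M N => by
    simp only [AComp.ren, AComp.sub, AComp.sub_ren _ _ M, AComp.sub_ren _ _ N, AVal.liftR_up]
  | .lam M => by simp only [AComp.ren, AComp.sub, AComp.sub_ren _ _ M, AVal.liftR_up]
  | .app M V => by simp only [AComp.ren, AComp.sub, AComp.sub_ren _ _ M, AVal.sub_ren ρ σ V]
  | .cpair M N => by simp only [AComp.ren, AComp.sub, AComp.sub_ren _ _ M, AComp.sub_ren _ _ N]
  | .prj _ M => by simp only [AComp.ren, AComp.sub, AComp.sub_ren _ _ M]
  | .label _ M => by simp only [AComp.ren, AComp.sub, AComp.sub_ren _ _ M]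
  | .create V => by simp only [AComp.ren, AComp.sub, AVal.sub_ren ρ σ V]
  | .resume V W => by
    simp only [AComp.ren, AComp.sub, AVal.sub_ren ρ σ V, AVal.sub_ren ρ σ W]
  | .yield V => by simp only [AComp.ren, AComp.sub, AVal.sub_ren ρ σ V]
theorem ABrs.sub_ren (ρ : ℕ → ℕ) (σ : ℕ → AVal) :
    ∀ B : ABrs, (B.sub σ).ren ρ = B.sub (fun n => (σ n).ren ρ)
  | .nil => rfl
  | .cons _ M B => by
    simp only [ABrs.ren, ABrs.sub, AComp.sub_ren _ _ M, ABrs.sub_ren ρ σ B, AVal.liftR_up]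
end

@[simp] theorem AVal.up_var : AVal.up AVal.var = AVal.var := by
  funext n; cases n <;> rfl

mutual
@[simp] theorem AVal.sub_var : ∀ V : AVal, V.sub AVal.var = V
  | .var _ => rfl
  | .unit => rfl
  | .lab _ => rfl
  | .pair V W => by simp only [AVal.sub, AVal.sub_var V, AVal.sub_var W]
  | .inj _ V => by simp only [AVal.sub, AVal.sub_var V]
  | .thunk M => by simp only [AVal.sub, AComp.sub_var M]
@[simp] theorem AComp.sub_var : ∀ M : AComp, M.sub AVal.var = M
  | .pcase V M => by simp only [AComp.sub, AVal.sub_var V, AComp.sub_var M, AVal.up_var]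
  | .scase V B => by simp only [AComp.sub, AVal.sub_var V, ABrs.sub_var B]
  | .force V => by simp only [AComp.sub, AVal.sub_var V]
  | .ret V => by simp only [AComp.sub, AVal.sub_var V]
  | .seq M N => by simp only [AComp.sub, AComp.sub_var M, AComp.sub_var N, AVal.up_var]
  | .lam M => by simp only [AComp.sub, AComp.sub_var M, AVal.up_var]
  | .app M V => by simp only [AComp.sub, AComp.sub_var M, AVal.sub_var V]
  | .cpair M N => by simp only [AComp.sub, AComp.sub_var M, AComp.sub_var N]
  | .prj _ M => by simp only [AComp.sub, AComp.sub_var M]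
  | .label _ M => by simp only [AComp.sub, AComp.sub_var M]
  | .create V => by simp only [AComp.sub, AVal.sub_var V]
  | .resume V W => by simp only [AComp.sub, AVal.sub_var V, AVal.sub_var W]
  | .yield V => by simp only [AComp.sub, AVal.sub_var V]
@[simp] theorem ABrs.sub_var : ∀ B : ABrs, B.sub AVal.var = B
  | .nil => rfl
  | .cons _ M B => by simp only [ABrs.sub, AComp.sub_var M, ABrs.sub_var B, AVal.up_var]
end

theorem AVal.sub_var_comp (V : AVal) (ρ : ℕ → ℕ) :
    V.sub (fun n => .var (ρ n)) = V.ren ρ := by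
  rw [← AVal.sub_var (V.ren ρ), AVal.ren_sub]

/-- Instantiating a variable that does not occur. -/
@[simp] theorem AComp.ren_succ_inst (M : AComp) (V : AVal) :
    (M.ren Nat.succ).inst V = M := by
  simp [AComp.inst, AComp.ren_sub]

theorem AComp.ren_succ_sub_up (M : AComp) (σ : ℕ → AVal) :
    (M.ren Nat.succ).sub (AVal.up σ) = (M.sub σ).ren Nat.succ := by
  simp [AComp.ren_sub, AComp.sub_ren]

mutual
@[simp] theorem AVal.active_ren (ρ : ℕ → ℕ) : ∀ V : AVal, (V.ren ρ).active = V.active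
  | .var _ => rfl
  | .unit => rfl
  | .lab _ => rfl
  | .pair V W => by simp only [AVal.ren, AVal.active, AVal.active_ren ρ V, AVal.active_ren ρ W]
  | .inj _ V => by simp only [AVal.ren, AVal.active, AVal.active_ren ρ V]
  | .thunk M => by simp only [AVal.ren, AVal.active, AComp.active_ren ρ M]
@[simp] theorem AComp.active_ren (ρ : ℕ → ℕ) : ∀ M : AComp, (M.ren ρ).active = M.active
  | .pcase V M => by
    simp only [AComp.ren, AComp.active, AVal.active_ren ρ V, AComp.active_ren _ M]
  | .scase V B => by
    simp only [AComp.ren, AComp.active, AVal.active_ren ρ V, ABrs.active_ren ρ B]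
  | .force V => by simp only [AComp.ren, AComp.active, AVal.active_ren ρ V]
  | .ret V => by simp only [AComp.ren, AComp.active, AVal.active_ren ρ V]
  | .seq M N => by
    simp only [AComp.ren, AComp.active, AComp.active_ren _ M, AComp.active_ren _ N]
  | .lam M => by simp only [AComp.ren, AComp.active, AComp.active_ren _ M]
  | .app M V => by
    simp only [AComp.ren, AComp.active, AComp.active_ren _ M, AVal.active_ren ρ V]
  | .cpair M N => by
    simp only [AComp.ren, AComp.active, AComp.active_ren _ M, AComp.active_ren _ N]
  | .prj _ M => by simp only [AComp.ren, AComp.active, AComp.active_ren _ M]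
  | .label _ M => by simp only [AComp.ren, AComp.active, AComp.active_ren _ M]
  | .create V => by simp only [AComp.ren, AComp.active, AVal.active_ren ρ V]
  | .resume V W => by
    simp only [AComp.ren, AComp.active, AVal.active_ren ρ V, AVal.active_ren ρ W]
  | .yield V => by simp only [AComp.ren, AComp.active, AVal.active_ren ρ V]
@[simp] theorem ABrs.active_ren (ρ : ℕ → ℕ) : ∀ B : ABrs, (B.ren ρ).active = B.active
  | .nil => rfl
  | .cons _ M B => by
    simp only [ABrs.ren, ABrs.active, AComp.active_ren _ M, ABrs.active_ren ρ B]
end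

/-! ### Closed auxiliary programs -/

@[simp] theorem num_ren (ρ : ℕ → ℕ) (n : ℕ) : (num n).ren ρ = num n := by
  induction n with
  | zero => rfl
  | succ n ih => simp [num, AVal.ren, ih]

@[simp] theorem num_sub (σ : ℕ → AVal) (n : ℕ) : (num n).sub σ = num n := by
  induction n with
  | zero => rfl
  | succ n ih => simp [num, AVal.sub, ih]

@[simp] theorem num_active (n : ℕ) : (num n).active = ∅ := by
  induction n with
  | zero => rfl
  | succ n ih => simp [num, AVal.active, ih]

@[simp] theorem triple_ren (ρ : ℕ → ℕ) (t : Label × Label × ℕ) : (triple t).ren ρ = triple t := by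
  simp [triple, AVal.ren]

@[simp] theorem triple_sub (σ : ℕ → AVal) (t : Label × Label × ℕ) :
    (triple t).sub σ = triple t := by
  simp [triple, AVal.sub]

@[simp] theorem triple_active (t : Label × Label × ℕ) : (triple t).active = ∅ := by
  simp [triple, AVal.active]

@[simp] theorem compareStep_sub (σ : ℕ → AVal) : compareStep.sub σ = compareStep := rfl
@[simp] theorem compareStep_ren (ρ : ℕ → ℕ) : compareStep.ren ρ = compareStep := rfl
@[simp] theorem cellStep_sub (σ : ℕ → AVal) : cellStep.sub σ = cellStep := rfl
@[simp] theorem cellStep_ren (ρ : ℕ → ℕ) : cellStep.ren ρ = cellStep := rfl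
@[simp] theorem incrV_sub (σ : ℕ → AVal) : incrV.sub σ = incrV := rfl
@[simp] theorem incrV_ren (ρ : ℕ → ℕ) : incrV.ren ρ = incrV := rfl
@[simp] theorem compareV_sub (σ : ℕ → AVal) : compareV.sub σ = compareV := rfl
@[simp] theorem compareV_ren (ρ : ℕ → ℕ) : compareV.ren ρ = compareV := rfl
@[simp] theorem refV_sub (σ : ℕ → AVal) : refV.sub σ = refV := rfl
@[simp] theorem refV_ren (ρ : ℕ → ℕ) : refV.ren ρ = refV := rfl
@[simp] theorem getV_sub (σ : ℕ → AVal) : getV.sub σ = getV := rfl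
@[simp] theorem getV_ren (ρ : ℕ → ℕ) : getV.ren ρ = getV := rfl
@[simp] theorem setV_sub (σ : ℕ → AVal) : setV.sub σ = setV := rfl
@[simp] theorem setV_ren (ρ : ℕ → ℕ) : setV.ren ρ = setV := rfl
@[simp] theorem failV_sub (σ : ℕ → AVal) : failV.sub σ = failV := rfl
@[simp] theorem failV_ren (ρ : ℕ → ℕ) : failV.ren ρ = failV := rfl

theorem refCell_active (V : AVal) : (refCell V).active = V.active := by
  simp [refCell, cellStep, AVal.active, AComp.active, ABrs.active]

/-! ### The macro-translation commutes with renaming and substitution -/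

theorem dollarMacro_ren (ρ : ℕ → ℕ) (N₁ N₂ : AComp) :
    (dollarMacro N₁ N₂).ren ρ = dollarMacro (N₁.ren ρ) (N₂.ren (liftR ρ)) := by
  simp only [dollarMacro, coBody, AComp.ren, AVal.ren, refV_ren, num_ren, AComp.ren_ren]
  -- `N₂` is weakened twice: past the inner `_`, and past the outer `_` while keeping its own
  -- variable `x`. Both sides agree on `x` (index `0`) and on the outer variables separately.
  have h : (fun n => liftR (liftR (liftR ρ)) (liftR (liftR Nat.succ) n.succ)) =
      fun n => liftR (liftR Nat.succ) (liftR ρ n).succ := by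
    funext n; cases n <;> rfl
  rw [h]
  rfl

theorem throwMacro_ren (ρ : ℕ → ℕ) (V W : AVal) :
    (throwMacro V W).ren ρ = throwMacro (V.ren ρ) (W.ren ρ) := by
  simp only [throwMacro, AComp.ren, ABrs.ren, AVal.ren, getV_ren, compareV_ren, incrV_ren,
    setV_ren, failV_ren, AVal.ren_ren]
  rfl

theorem coBody_sub (σ : ℕ → AVal) (N₁ N₂ : AComp) :
    (coBody N₁ N₂).sub σ = coBody (N₁.sub σ) (N₂.sub (AVal.up σ)) := by
  simp only [coBody, AComp.sub, AVal.sub, AComp.ren_succ_sub_up]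

theorem dollarMacro_sub (σ : ℕ → AVal) (N₁ N₂ : AComp) :
    (dollarMacro N₁ N₂).sub σ = dollarMacro (N₁.sub σ) (N₂.sub (AVal.up σ)) := by
  rw [dollarMacro, dollarMacro, ← coBody_sub, ← AComp.ren_succ_sub_up]
  simp only [AComp.sub, AVal.sub, refV_sub, num_sub]
  rfl

theorem throwMacro_sub (σ : ℕ → AVal) (V W : AVal) :
    (throwMacro V W).sub σ = throwMacro (V.sub σ) (W.sub σ) := by
  simp only [throwMacro, AComp.sub, ABrs.sub, AVal.sub, getV_sub, compareV_sub, incrV_sub,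
    setV_sub, failV_sub, AVal.ren_sub, AVal.sub_ren, AVal.up_succ, AVal.up_zero, AVal.ren,
    AVal.ren_ren]

theorem coBody_active (N₁ N₂ : AComp) : (coBody N₁ N₂).active = N₁.active ∪ N₂.active := by
  simp [coBody, AComp.active, AVal.active]

theorem dollarMacro_active (N₁ N₂ : AComp) :
    (dollarMacro N₁ N₂).active = N₁.active ∪ N₂.active := by
  simp [dollarMacro, coBody_active, AComp.active, AVal.active, refV, refCell_active]

theorem throwMacro_active (V W : AVal) : (throwMacro V W).active = V.active ∪ W.active := by
  simp [throwMacro, AComp.active, AVal.active, ABrs.active, getV, compareV, compareStep, incrV,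
    setV, failV]

mutual
theorem DVal.tr_ren (η : Env) (ρ : ℕ → ℕ) : ∀ V : DVal, (V.ren ρ).tr η = (V.tr η).ren ρ
  | .var _ => rfl
  | .unit => rfl
  | .lab l => by
    cases h : η l <;> simp [DVal.ren, DVal.tr, h, AVal.ren]
  | .pair V W => by simp only [DVal.ren, DVal.tr, AVal.ren, DVal.tr_ren η ρ V, DVal.tr_ren η ρ W]
  | .inj _ V => by simp only [DVal.ren, DVal.tr, AVal.ren, DVal.tr_ren η ρ V]
  | .thunk M => by simp only [DVal.ren, DVal.tr, AVal.ren, DComp.tr_ren η ρ M]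
theorem DComp.tr_ren (η : Env) (ρ : ℕ → ℕ) : ∀ M : DComp, (M.ren ρ).tr η = (M.tr η).ren ρ
  | .pcase V M => by
    simp only [DComp.ren, DComp.tr, AComp.ren, DVal.tr_ren η ρ V, DComp.tr_ren η _ M]
  | .scase V B => by
    simp only [DComp.ren, DComp.tr, AComp.ren, DVal.tr_ren η ρ V, DBrs.tr_ren η _ B]
  | .force V => by simp only [DComp.ren, DComp.tr, AComp.ren, DVal.tr_ren η ρ V]
  | .ret V => by simp only [DComp.ren, DComp.tr, AComp.ren, DVal.tr_ren η ρ V]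
  | .seq M N => by
    simp only [DComp.ren, DComp.tr, AComp.ren, DComp.tr_ren η _ M, DComp.tr_ren η _ N]
  | .lam M => by simp only [DComp.ren, DComp.tr, AComp.ren, DComp.tr_ren η _ M]
  | .app M V => by
    simp only [DComp.ren, DComp.tr, AComp.ren, DComp.tr_ren η _ M, DVal.tr_ren η ρ V]
  | .cpair M N => by
    simp only [DComp.ren, DComp.tr, AComp.ren, DComp.tr_ren η _ M, DComp.tr_ren η _ N]
  | .prj _ M => by simp only [DComp.ren, DComp.tr, AComp.ren, DComp.tr_ren η _ M]
  | .shift M => by simp only [DComp.ren, DComp.tr, AComp.ren, AVal.ren, DComp.tr_ren η _ M]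
  | .dollar M N => by
    simp only [DComp.ren, DComp.tr, dollarMacro_ren, DComp.tr_ren η _ M, DComp.tr_ren η _ N]
  | .throw V W => by
    simp only [DComp.ren, DComp.tr, throwMacro_ren, DVal.tr_ren η _ V, DVal.tr_ren η _ W]
theorem DBrs.tr_ren (η : Env) (ρ : ℕ → ℕ) : ∀ B : DBrs, (B.ren ρ).tr η = (B.tr η).ren ρ
  | .nil => rfl
  | .cons _ M B => by
    simp only [DBrs.ren, DBrs.tr, ABrs.ren, DComp.tr_ren η _ M, DBrs.tr_ren η ρ B]
end

theorem DVal.up_tr (η : Env) (σ : ℕ → DVal) :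
    (fun n => (DVal.up σ n).tr η) = AVal.up (fun n => (σ n).tr η) := by
  funext n
  cases n with
  | zero => rfl
  | succ n => exact DVal.tr_ren η _ _

mutual
theorem DVal.tr_sub (η : Env) (σ : ℕ → DVal) :
    ∀ V : DVal, (V.sub σ).tr η = (V.tr η).sub (fun n => (σ n).tr η)
  | .var _ => rfl
  | .unit => rfl
  | .lab l => by
    cases h : η l <;> simp [DVal.sub, DVal.tr, h, AVal.sub]
  | .pair V W => by simp only [DVal.sub, DVal.tr, AVal.sub, DVal.tr_sub η σ V, DVal.tr_sub η σ W]
  | .inj _ V => by simp only [DVal.sub, DVal.tr, AVal.sub, DVal.tr_sub η σ V]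
  | .thunk M => by simp only [DVal.sub, DVal.tr, AVal.sub, DComp.tr_sub η σ M]
theorem DComp.tr_sub (η : Env) (σ : ℕ → DVal) :
    ∀ M : DComp, (M.sub σ).tr η = (M.tr η).sub (fun n => (σ n).tr η)
  | .pcase V M => by
    simp only [DComp.sub, DComp.tr, AComp.sub, DVal.tr_sub η σ V, DComp.tr_sub η _ M, DVal.up_tr]
  | .scase V B => by
    simp only [DComp.sub, DComp.tr, AComp.sub, DVal.tr_sub η σ V, DBrs.tr_sub η _ B]
  | .force V => by simp only [DComp.sub, DComp.tr, AComp.sub, DVal.tr_sub η σ V]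
  | .ret V => by simp only [DComp.sub, DComp.tr, AComp.sub, DVal.tr_sub η σ V]
  | .seq M N => by
    simp only [DComp.sub, DComp.tr, AComp.sub, DComp.tr_sub η _ M, DComp.tr_sub η _ N, DVal.up_tr]
  | .lam M => by simp only [DComp.sub, DComp.tr, AComp.sub, DComp.tr_sub η _ M, DVal.up_tr]
  | .app M V => by
    simp only [DComp.sub, DComp.tr, AComp.sub, DComp.tr_sub η _ M, DVal.tr_sub η σ V]
  | .cpair M N => by
    simp only [DComp.sub, DComp.tr, AComp.sub, DComp.tr_sub η _ M, DComp.tr_sub η _ N]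
  | .prj _ M => by simp only [DComp.sub, DComp.tr, AComp.sub, DComp.tr_sub η _ M]
  | .shift M => by
    simp only [DComp.sub, DComp.tr, AComp.sub, AVal.sub, DComp.tr_sub η _ M, DVal.up_tr]
  | .dollar M N => by
    simp only [DComp.sub, DComp.tr, dollarMacro_sub, DComp.tr_sub η _ M, DComp.tr_sub η _ N,
      DVal.up_tr]
  | .throw V W => by
    simp only [DComp.sub, DComp.tr, throwMacro_sub, DVal.tr_sub η _ V, DVal.tr_sub η _ W]
theorem DBrs.tr_sub (η : Env) (σ : ℕ → DVal) :
    ∀ B : DBrs, (B.sub σ).tr η = (B.tr η).sub (fun n => (σ n).tr η)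
  | .nil => rfl
  | .cons _ M B => by
    simp only [DBrs.sub, DBrs.tr, ABrs.sub, DComp.tr_sub η _ M, DBrs.tr_sub η σ B, DVal.up_tr]
end

/-- This is what lets a common `β`-step be matched by the same `β`-step on translations. -/
theorem DComp.tr_inst (η : Env) (M : DComp) (V : DVal) :
    (M.inst V).tr η = (M.tr η).inst (V.tr η) := by
  rw [DComp.inst, AComp.inst, DComp.tr_sub]
  congr 1; funext n; cases n <;> rfl

theorem DComp.tr_inst2 (η : Env) (M : DComp) (V W : DVal) :
    (M.inst2 V W).tr η = (M.tr η).inst2 (V.tr η) (W.tr η) := by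
  rw [DComp.inst2, AComp.inst2, DComp.tr_sub]
  congr 1; funext n; rcases n with _ | _ | n <;> rfl

theorem DBrs.find_tr (η : Env) (L : Tag) :
    ∀ {B : DBrs} {M : DComp}, B.find L = some M → (B.tr η).find L = some (M.tr η)
  | .nil, _, h => by simp [DBrs.find] at h
  | .cons L' N B, M, h => by
    simp only [DBrs.find] at h
    simp only [DBrs.tr, ABrs.find]
    split_ifs at h ⊢ with hL
    · cases h; rfl
    · exact DBrs.find_tr η L h

-- Neither the macros nor the auxiliary programs contain labelled computations. Active labels can
-- therefore come only from the running delimiters of a context.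
mutual
@[simp] theorem DVal.tr_active (η : Env) : ∀ V : DVal, (V.tr η).active = ∅
  | .var _ => rfl
  | .unit => rfl
  | .lab l => by cases h : η l <;> simp [DVal.tr, h, AVal.active]
  | .pair V W => by simp [DVal.tr, AVal.active, DVal.tr_active η V, DVal.tr_active η W]
  | .inj _ V => by simp [DVal.tr, AVal.active, DVal.tr_active η V]
  | .thunk M => by simp [DVal.tr, AVal.active, DComp.tr_active η M]
@[simp] theorem DComp.tr_active (η : Env) : ∀ M : DComp, (M.tr η).active = ∅
  | .pcase V M => by simp [DComp.tr, AComp.active, DVal.tr_active η V, DComp.tr_active η M]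
  | .scase V B => by simp [DComp.tr, AComp.active, DVal.tr_active η V, DBrs.tr_active η B]
  | .force V => by simp [DComp.tr, AComp.active, DVal.tr_active η V]
  | .ret V => by simp [DComp.tr, AComp.active, DVal.tr_active η V]
  | .seq M N => by simp [DComp.tr, AComp.active, DComp.tr_active η M, DComp.tr_active η N]
  | .lam M => by simp [DComp.tr, AComp.active, DComp.tr_active η M]
  | .app M V => by simp [DComp.tr, AComp.active, DVal.tr_active η V, DComp.tr_active η M]
  | .cpair M N => by simp [DComp.tr, AComp.active, DComp.tr_active η M, DComp.tr_active η N]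
  | .prj _ M => by simp [DComp.tr, AComp.active, DComp.tr_active η M]
  | .shift M => by simp [DComp.tr, AComp.active, AVal.active, DComp.tr_active η M]
  | .dollar M N => by
    simp [DComp.tr, dollarMacro_active, DComp.tr_active η M, DComp.tr_active η N]
  | .throw V W => by simp [DComp.tr, throwMacro_active, DVal.tr_active η V, DVal.tr_active η W]
@[simp] theorem DBrs.tr_active (η : Env) : ∀ B : DBrs, (B.tr η).active = ∅
  | .nil => rfl
  | .cons _ M B => by simp [DBrs.tr, ABrs.active, DComp.tr_active η M, DBrs.tr_active η B]
end

/-! ### Labels and changes of the environment -/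

-- Used to extend `η` at a fresh label: existing terms do not mention it, so their translations do
-- not change.
mutual
theorem DVal.tr_congr {η η' : Env} : ∀ {V : DVal}, (∀ l ∈ V.labels, η l = η' l) →
    V.tr η = V.tr η'
  | .var _, _ => rfl
  | .unit, _ => rfl
  | .lab l, h => by simp only [DVal.tr, h l (Set.mem_singleton l)]
  | .pair _ _, h => by
    rw [DVal.tr, DVal.tr, DVal.tr_congr fun l hl => h l (.inl hl),
      DVal.tr_congr fun l hl => h l (.inr hl)]
  | .inj _ V, h => by rw [DVal.tr, DVal.tr, DVal.tr_congr (V := V) h]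
  | .thunk M, h => by rw [DVal.tr, DVal.tr, DComp.tr_congr (M := M) h]
theorem DComp.tr_congr {η η' : Env} : ∀ {M : DComp}, (∀ l ∈ M.labels, η l = η' l) →
    M.tr η = M.tr η'
  | .pcase _ _, h => by
    rw [DComp.tr, DComp.tr, DVal.tr_congr fun l hl => h l (.inl hl),
      DComp.tr_congr fun l hl => h l (.inr hl)]
  | .scase _ _, h => by
    rw [DComp.tr, DComp.tr, DVal.tr_congr fun l hl => h l (.inl hl),
      DBrs.tr_congr fun l hl => h l (.inr hl)]
  | .force V, h => by rw [DComp.tr, DComp.tr, DVal.tr_congr (V := V) h]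
  | .ret V, h => by rw [DComp.tr, DComp.tr, DVal.tr_congr (V := V) h]
  | .seq _ _, h => by
    rw [DComp.tr, DComp.tr, DComp.tr_congr fun l hl => h l (.inl hl),
      DComp.tr_congr fun l hl => h l (.inr hl)]
  | .lam M, h => by rw [DComp.tr, DComp.tr, DComp.tr_congr (M := M) h]
  | .app _ _, h => by
    rw [DComp.tr, DComp.tr, DComp.tr_congr fun l hl => h l (.inl hl),
      DVal.tr_congr fun l hl => h l (.inr hl)]
  | .cpair _ _, h => by
    rw [DComp.tr, DComp.tr, DComp.tr_congr fun l hl => h l (.inl hl),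
      DComp.tr_congr fun l hl => h l (.inr hl)]
  | .prj _ M, h => by rw [DComp.tr, DComp.tr, DComp.tr_congr (M := M) h]
  | .shift M, h => by rw [DComp.tr, DComp.tr, DComp.tr_congr (M := M) h]
  | .dollar _ _, h => by
    rw [DComp.tr, DComp.tr, DComp.tr_congr fun l hl => h l (.inl hl),
      DComp.tr_congr fun l hl => h l (.inr hl)]
  | .throw _ _, h => by
    rw [DComp.tr, DComp.tr, DVal.tr_congr fun l hl => h l (.inl hl),
      DVal.tr_congr fun l hl => h l (.inr hl)]
theorem DBrs.tr_congr {η η' : Env} : ∀ {B : DBrs}, (∀ l ∈ B.labels, η l = η' l) →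
    B.tr η = B.tr η'
  | .nil, _ => rfl
  | .cons _ _ _, h => by
    rw [DBrs.tr, DBrs.tr, DComp.tr_congr fun l hl => h l (.inl hl),
      DBrs.tr_congr fun l hl => h l (.inr hl)]
end

theorem DPCtx.tr_congr {η η' : Env} : ∀ {H : DPCtx}, (∀ l ∈ H.labels, η l = η' l) →
    H.tr η = H.tr η'
  | .hole, _ => rfl
  | .seq _ _, h => by
    rw [DPCtx.tr, DPCtx.tr, DPCtx.tr_congr fun l hl => h l (.inl hl),
      DComp.tr_congr fun l hl => h l (.inr hl)]
  | .app _ _, h => by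
    rw [DPCtx.tr, DPCtx.tr, DPCtx.tr_congr fun l hl => h l (.inl hl),
      DVal.tr_congr fun l hl => h l (.inr hl)]
  | .prj _ H, h => by rw [DPCtx.tr, DPCtx.tr, DPCtx.tr_congr (H := H) h]

mutual
@[simp] theorem DVal.labels_ren (ρ : ℕ → ℕ) : ∀ V : DVal, (V.ren ρ).labels = V.labels
  | .var _ => rfl
  | .unit => rfl
  | .lab _ => rfl
  | .pair V W => by simp only [DVal.ren, DVal.labels, DVal.labels_ren ρ V, DVal.labels_ren ρ W]
  | .inj _ V => by simp only [DVal.ren, DVal.labels, DVal.labels_ren ρ V]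
  | .thunk M => by simp only [DVal.ren, DVal.labels, DComp.labels_ren ρ M]
@[simp] theorem DComp.labels_ren (ρ : ℕ → ℕ) : ∀ M : DComp, (M.ren ρ).labels = M.labels
  | .pcase V M => by
    simp only [DComp.ren, DComp.labels, DVal.labels_ren ρ V, DComp.labels_ren _ M]
  | .scase V B => by
    simp only [DComp.ren, DComp.labels, DVal.labels_ren ρ V, DBrs.labels_ren ρ B]
  | .force V => by simp only [DComp.ren, DComp.labels, DVal.labels_ren ρ V]
  | .ret V => by simp only [DComp.ren, DComp.labels, DVal.labels_ren ρ V]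
  | .seq M N => by
    simp only [DComp.ren, DComp.labels, DComp.labels_ren _ M, DComp.labels_ren _ N]
  | .lam M => by simp only [DComp.ren, DComp.labels, DComp.labels_ren _ M]
  | .app M V => by
    simp only [DComp.ren, DComp.labels, DComp.labels_ren _ M, DVal.labels_ren ρ V]
  | .cpair M N => by
    simp only [DComp.ren, DComp.labels, DComp.labels_ren _ M, DComp.labels_ren _ N]
  | .prj _ M => by simp only [DComp.ren, DComp.labels, DComp.labels_ren _ M]
  | .shift M => by simp only [DComp.ren, DComp.labels, DComp.labels_ren _ M]
  | .dollar M N => by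
    simp only [DComp.ren, DComp.labels, DComp.labels_ren _ M, DComp.labels_ren _ N]
  | .throw V W => by
    simp only [DComp.ren, DComp.labels, DVal.labels_ren _ V, DVal.labels_ren ρ W]
@[simp] theorem DBrs.labels_ren (ρ : ℕ → ℕ) : ∀ B : DBrs, (B.ren ρ).labels = B.labels
  | .nil => rfl
  | .cons _ M B => by
    simp only [DBrs.ren, DBrs.labels, DComp.labels_ren _ M, DBrs.labels_ren ρ B]
end

theorem DVal.labels_up {S : Set Label} {σ : ℕ → DVal} (h : ∀ n, (σ n).labels ⊆ S) (n : ℕ) :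
    (DVal.up σ n).labels ⊆ S := by
  cases n with
  | zero => exact Set.empty_subset S
  | succ n => exact (DVal.labels_ren _ _).trans_subset (h n)

mutual
theorem DVal.labels_sub {S : Set Label} {σ : ℕ → DVal} (h : ∀ n, (σ n).labels ⊆ S) :
    ∀ {V : DVal}, V.labels ⊆ S → (V.sub σ).labels ⊆ S
  | .var n, _ => h n
  | .unit, hV => hV
  | .lab _, hV => hV
  | .pair _ _, hV => by
    have := Set.union_subset_iff.1 hV
    exact Set.union_subset (DVal.labels_sub h this.1) (DVal.labels_sub h this.2)
  | .inj _ V, hV => DVal.labels_sub (V := V) h hV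
  | .thunk M, hV => DComp.labels_sub (M := M) h hV
theorem DComp.labels_sub {S : Set Label} {σ : ℕ → DVal} (h : ∀ n, (σ n).labels ⊆ S) :
    ∀ {M : DComp}, M.labels ⊆ S → (M.sub σ).labels ⊆ S
  | .pcase _ _, hM => by
    have := Set.union_subset_iff.1 hM
    exact Set.union_subset (DVal.labels_sub h this.1)
      (DComp.labels_sub (DVal.labels_up (DVal.labels_up h)) this.2)
  | .scase _ _, hM => by
    have := Set.union_subset_iff.1 hM
    exact Set.union_subset (DVal.labels_sub h this.1) (DBrs.labels_sub h this.2)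
  | .force V, hM => DVal.labels_sub (V := V) h hM
  | .ret V, hM => DVal.labels_sub (V := V) h hM
  | .seq _ _, hM => by
    have := Set.union_subset_iff.1 hM
    exact Set.union_subset (DComp.labels_sub h this.1)
      (DComp.labels_sub (DVal.labels_up h) this.2)
  | .lam M, hM => DComp.labels_sub (M := M) (DVal.labels_up h) hM
  | .app _ _, hM => by
    have := Set.union_subset_iff.1 hM
    exact Set.union_subset (DComp.labels_sub h this.1) (DVal.labels_sub h this.2)
  | .cpair _ _, hM => by
    have := Set.union_subset_iff.1 hM
    exact Set.union_subset (DComp.labels_sub h this.1) (DComp.labels_sub h this.2)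
  | .prj _ M, hM => DComp.labels_sub (M := M) h hM
  | .shift M, hM => DComp.labels_sub (M := M) (DVal.labels_up h) hM
  | .dollar _ _, hM => by
    have := Set.union_subset_iff.1 hM
    exact Set.union_subset (DComp.labels_sub h this.1)
      (DComp.labels_sub (DVal.labels_up h) this.2)
  | .throw _ _, hM => by
    have := Set.union_subset_iff.1 hM
    exact Set.union_subset (DVal.labels_sub h this.1) (DVal.labels_sub h this.2)
theorem DBrs.labels_sub {S : Set Label} {σ : ℕ → DVal} (h : ∀ n, (σ n).labels ⊆ S) :
    ∀ {B : DBrs}, B.labels ⊆ S → (B.sub σ).labels ⊆ S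
  | .nil, hB => hB
  | .cons _ _ _, hB => by
    have := Set.union_subset_iff.1 hB
    exact Set.union_subset (DComp.labels_sub (DVal.labels_up h) this.1)
      (DBrs.labels_sub h this.2)
end

theorem DComp.labels_inst {S : Set Label} {M : DComp} {V : DVal} (hM : M.labels ⊆ S)
    (hV : V.labels ⊆ S) : (M.inst V).labels ⊆ S :=
  DComp.labels_sub (fun n => by cases n; exacts [hV, Set.empty_subset S]) hM

theorem DComp.labels_inst2 {S : Set Label} {M : DComp} {V W : DVal} (hM : M.labels ⊆ S)
    (hV : V.labels ⊆ S) (hW : W.labels ⊆ S) : (M.inst2 V W).labels ⊆ S :=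
  DComp.labels_sub
    (fun n => by rcases n with _ | _ | n; exacts [hW, hV, Set.empty_subset S]) hM

theorem DBrs.labels_find {S : Set Label} {L : Tag} :
    ∀ {B : DBrs} {M : DComp}, B.find L = some M → B.labels ⊆ S → M.labels ⊆ S
  | .nil, _, h, _ => by simp [DBrs.find] at h
  | .cons L' N B, M, h, hS => by
    simp only [DBrs.find] at h
    have := Set.union_subset_iff.1 hS
    split_ifs at h with hL
    · cases h; exact this.1
    · exact DBrs.labels_find h this.2

/-! ### Reduction in evaluation contexts -/

/-- Composition of evaluation contexts. -/
def ACtx.comp : ACtx → ACtx → ACtx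
  | .hole, E => E
  | .seq D N, E => .seq (D.comp E) N
  | .app D V, E => .app (D.comp E) V
  | .prj i D, E => .prj i (D.comp E)
  | .label l D, E => .label l (D.comp E)

theorem ACtx.plug_comp (D E : ACtx) (N : AComp) : (D.comp E).plug N = D.plug (E.plug N) := by
  induction D <;> simp_all [ACtx.comp, ACtx.plug]

theorem AConf.inCtx_inCtx (D E : ACtx) (R : AConf) :
    (R.inCtx E).inCtx D = R.inCtx (D.comp E) := by
  cases R <;> simp [AConf.inCtx, ACtx.plug_comp]

theorem AStep.inCtx (D : ACtx) {c c' : AConf} (h : AStep c c') :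
    AStep (c.inCtx D) (c'.inCtx D) := by
  cases h with
  | mk E N τ R hb =>
    rw [AConf.inCtx_inCtx, AConf.inCtx, ← ACtx.plug_comp]
    exact .mk _ _ _ _ hb

/-- One or more reduction steps. -/
abbrev APlus (c c' : AConf) : Prop := Relation.TransGen AStep c c'

/-- Any number of reduction steps. -/
abbrev AStar (c c' : AConf) : Prop := Relation.ReflTransGen AStep c c'

theorem APlus.inCtx (D : ACtx) {c c' : AConf} (h : APlus c c') :
    APlus (c.inCtx D) (c'.inCtx D) :=
  Relation.TransGen.lift (AConf.inCtx D) (fun _ _ h => h.inCtx D) _ _ h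

theorem AStar.inCtx (D : ACtx) {c c' : AConf} (h : AStar c c') :
    AStar (c.inCtx D) (c'.inCtx D) :=
  Relation.ReflTransGen.lift (AConf.inCtx D) (fun _ _ h => h.inCtx D) _ _ h

theorem APlus.beta {N : AComp} {τ : AStore} {R : AConf} (h : ABeta N τ R) :
    APlus (.conf N τ) R := by
  have := AStep.mk .hole N τ R h
  -- Plugging into the empty context is the identity only after the configuration has been split
  -- into `⊥` and a pair.
  cases R <;> exact .single this

theorem APlus.seq {M M' : AComp} {τ τ' : AStore} (N : AComp)
    (h : APlus (.conf M τ) (.conf M' τ')) : APlus (.conf (.seq M N) τ) (.conf (.seq M' N) τ') :=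
  h.inCtx (.seq .hole N)

theorem APlus.app {M M' : AComp} {τ τ' : AStore} (V : AVal)
    (h : APlus (.conf M τ) (.conf M' τ')) : APlus (.conf (.app M V) τ) (.conf (.app M' V) τ') :=
  h.inCtx (.app .hole V)

theorem APlus.label {M M' : AComp} {τ τ' : AStore} (l : Label)
    (h : APlus (.conf M τ) (.conf M' τ')) :
    APlus (.conf (.label l M) τ) (.conf (.label l M') τ') :=
  h.inCtx (.label l .hole)

/-- Run the first computation of a sequence to a result and continue with the second. -/
theorem APlus.bind {M N N' : AComp} {V : AVal} {τ τ' : AStore} {R : AConf}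
    (h : APlus (.conf M τ) (.conf (.ret V) τ')) (hN : N.inst V = N')
    (h' : APlus (.conf N' τ') R) : APlus (.conf (.seq M N) τ) R :=
  ((h.seq N).trans (hN ▸ APlus.beta (.seq V N τ'))).trans h'

theorem APlus.bindRet {M N N' : AComp} {V : AVal} {τ τ' : AStore}
    (h : APlus (.conf M τ) (.conf (.ret V) τ')) (hN : N.inst V = N') :
    APlus (.conf (.seq M N) τ) (.conf N' τ') :=
  (h.seq N).trans (hN ▸ APlus.beta (.seq V N τ'))

theorem APlus.scase {L : Tag} {V : AVal} {B : ABrs} {M N : AComp} {τ : AStore}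
    (h : B.find L = some M) (hN : M.inst V = N) :
    APlus (.conf (.scase (.inj L V) B) τ) (.conf N τ) :=
  hN ▸ APlus.beta (.scase L V B M τ h)

theorem APlus.pcase {V W : AVal} {M N : AComp} {τ : AStore} (hN : M.inst2 V W = N) :
    APlus (.conf (.pcase (.pair V W) M) τ) (.conf N τ) :=
  hN ▸ APlus.beta (.pcase V W M τ)

theorem APlus.call (M : AComp) (V : AVal) (τ : AStore) :
    APlus (.conf (.app (.force (.thunk (.lam M))) V) τ) (.conf (M.inst V) τ) :=
  (APlus.app V (APlus.beta (.force _ τ))).trans (APlus.beta (.app M V τ))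

theorem APlus.call₂ (M : AComp) (V W : AVal) (τ : AStore) :
    APlus (.conf (.app (.app (.force (.thunk (.lam (.lam M)))) V) W) τ)
      (.conf ((M.sub (AVal.up (scons V AVal.var))).inst W) τ) :=
  (APlus.app W (.call _ V τ)).trans (APlus.beta (.app _ W τ))

theorem APlus.call₃ (M : AComp) (U V W : AVal) (τ : AStore) :
    APlus (.conf (.app (.app (.app (.force (.thunk (.lam (.lam (.lam M))))) U) V) W) τ)
      (.conf ((((M.sub (AVal.up (AVal.up (scons U AVal.var)))).sub
        (AVal.up (scons V AVal.var)))).inst W) τ) :=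
  (APlus.app W (.call₂ _ U V τ)).trans (APlus.beta (.app _ W τ))

/-- A resumption empties a location that the next yield fills again, or it empties a location that
was filled just before; only the last write matters. -/
theorem AStore.insert_nil_insert (τ : AStore) (l : Label) (s s' : Slot AVal) :
    (τ.insert l s).insert l s' = τ.insert l s' := by
  apply Finmap.ext_lookup
  intro x
  by_cases h : x = l
  · subst h; simp
  · simp [Finmap.lookup_insert_of_ne, h]

theorem AStore.insert_lookup {τ : AStore} {l : Label} {s : Slot AVal}
    (h : τ.lookup l = some s) : τ.insert l s = τ := by
  apply Finmap.ext_lookup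
  intro x
  by_cases hx : x = l
  · subst hx; simp [h]
  · simp [Finmap.lookup_insert_of_ne, hx]

theorem AStore.exists_fresh (τ : AStore) : ∃ l, l ∉ τ := by
  obtain ⟨l, hl⟩ := Infinite.exists_notMem_finset τ.keys
  exact ⟨l, fun h => hl (Finmap.mem_keys.2 h)⟩

theorem APlus.resume {l : Label} {M N : AComp} {W : AVal} {τ : AStore}
    (hl : τ.lookup l = some (.full (.thunk (.lam M)))) (hN : M.inst W = N) :
    APlus (.conf (.resume (.lab l) W) τ) (.conf (.label l N) (τ.insert l .nil)) :=
  (APlus.beta (.resume l _ W τ hl)).trans (hN ▸ APlus.label l (APlus.call M W _))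

/-! ### Running the auxiliary programs -/

/-- The state of a reference cell that waits for a request `c`. -/
def cellLoop (i : ℕ) (c : AVal) : AComp :=
  .app (.app (.app (.force cellStep) cellStep) (num i)) c

theorem refCell_call_num (i : ℕ) (c : AVal) (τ : AStore) :
    APlus (.conf (.app (.force (refCell (num i))) c) τ) (.conf (cellLoop i c) τ) := by
  refine (APlus.call _ c τ).trans (APlus.beta ?_)
  have := ABeta.seq c (cellLoop i (.var 0)) τ
  simpa [AComp.inst, AComp.sub, AVal.sub, cellLoop] using this

/-- The seemingly redundant `c ← return y` in `refCell` pays off here: the continuation captured by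
a yielding cell is syntactically a new cell, so `GetNum` can be an equation on the store. -/
theorem cell_reify (i : ℕ) :
    (APCtx.seq .hole (cellLoop i (.var 0))).reify = refCell (num i) := by
  simp [APCtx.reify, APCtx.ren, APCtx.plug, cellLoop, refCell, AComp.ren, AVal.ren]

/-- The cell answers with its content and passes the same content to the recursive call; for a set
request it answers `()` and passes on the new content. -/
theorem cellLoop_get (i : ℕ) (τ : AStore) :
    APlus (.conf (cellLoop i (.inj tagGet .unit)) τ)
      (.conf (.seq (.yield (num i)) (cellLoop i (.var 0))) τ) := by
  refine (APlus.call₃ _ _ _ _ τ).trans ?_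
  simp only [AComp.inst, AComp.sub, ABrs.sub, AVal.sub]
  refine APlus.scase rfl ?_
  simp [AComp.inst, AComp.sub, AVal.sub, AVal.ren, cellLoop]

theorem cellLoop_set (i k : ℕ) (τ : AStore) :
    APlus (.conf (cellLoop i (.inj tagSet (num k))) τ)
      (.conf (.seq (.yield .unit) (cellLoop k (.var 0))) τ) := by
  refine (APlus.call₃ _ _ _ _ τ).trans ?_
  simp only [AComp.inst, AComp.sub, ABrs.sub, AVal.sub]
  refine APlus.scase rfl ?_
  simp [AComp.inst, AComp.sub, AVal.sub, AVal.ren, cellLoop]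

/-- A reference cell that answers a request `c` by `V` and keeps the content `k`. -/
theorem resume_refCell {l : Label} {i k : ℕ} {c V : AVal} {τ : AStore} (hl : GetNum l τ i)
    (h : ∀ τ', APlus (.conf (cellLoop i c) τ')
      (.conf (.seq (.yield V) (cellLoop k (.var 0))) τ')) :
    APlus (.conf (.resume (.lab l) c) τ)
      (.conf (.ret V) (τ.insert l (.full (refCell (num k))))) := by
  refine (APlus.beta (.resume l _ c τ hl)).trans
    ((APlus.label l ((refCell_call_num i c _).trans (h _))).trans ?_)
  -- The captured context is the single frame that waits for the next request. Reified, it is the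
  -- cell with content `k`, and it overwrites the `nil` left by the resumption.
  have := APlus.beta (.yield l (.seq .hole (cellLoop k (.var 0))) V (τ.insert l .nil))
  rwa [cell_reify, AStore.insert_nil_insert] at this

theorem getV_run {l : Label} {i : ℕ} {τ : AStore} (hl : GetNum l τ i) :
    APlus (.conf (.app (.force getV) (.lab l)) τ) (.conf (.ret (num i)) τ) := by
  have h := resume_refCell hl (cellLoop_get i)
  -- Reading stores back the same content, so the store is unchanged on the nose.
  rw [AStore.insert_lookup hl] at h
  exact (APlus.call _ _ τ).trans h

theorem setV_run {l : Label} {i : ℕ} (k : ℕ) {τ : AStore} (hl : GetNum l τ i) :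
    APlus (.conf (.app (.app (.force setV) (.lab l)) (num k)) τ)
      (.conf (.ret .unit) (τ.insert l (.full (refCell (num k))))) := by
  refine (APlus.call₂ _ _ _ τ).trans ?_
  simpa [AComp.inst, AComp.sub, AVal.sub, AVal.ren] using resume_refCell hl (cellLoop_set i k)

theorem refV_run (k : ℕ) {l : Label} {τ : AStore} (hl : l ∉ τ) :
    APlus (.conf (.app (.force refV) (num k)) τ)
      (.conf (.ret (.lab l)) (τ.insert l (.full (refCell (num k))))) := by
  refine (APlus.call _ _ τ).trans ?_
  have : (AComp.create (refCell (.var 0))).inst (num k) = .create (refCell (num k)) := by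
    simp [AComp.inst, AComp.sub, AVal.sub, refCell, AVal.ren]
  rw [this]
  exact APlus.beta (.create _ τ l hl)

theorem incrV_run (i : ℕ) (τ : AStore) :
    APlus (.conf (.app (.force incrV) (num i)) τ) (.conf (.ret (num (i + 1))) τ) :=
  APlus.call _ _ τ

/-- The equality test applied to itself. -/
def compareLoop (V W : AVal) : AComp :=
  .app (.app (.app (.force compareStep) compareStep) V) W

/-- The result of the equality test. -/
def compareTag (i j : ℕ) : Tag := if i = j then tagTrue else tagFalse

/-- Simultaneous recursion on both numerals: after two case distinctions either the answer is known,
or the self-application has unfolded to the loop on the predecessors. -/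
theorem compareLoop_run (τ : AStore) : ∀ i j : ℕ,
    APlus (.conf (compareLoop (num i) (num j)) τ)
      (.conf (.ret (.inj (compareTag i j) .unit)) τ)
  | 0, 0 => by
    refine (APlus.call₃ _ _ _ _ τ).trans ?_
    simp only [AComp.inst, AComp.sub, ABrs.sub, AVal.sub]
    refine (APlus.scase rfl rfl).trans ?_
    exact APlus.scase rfl rfl
  | 0, j + 1 => by
    refine (APlus.call₃ _ _ _ _ τ).trans ?_
    simp only [AComp.inst, AComp.sub, ABrs.sub, AVal.sub]
    refine (APlus.scase rfl rfl).trans ?_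
    exact APlus.scase rfl rfl
  | i + 1, 0 => by
    refine (APlus.call₃ _ _ _ _ τ).trans ?_
    simp only [AComp.inst, AComp.sub, ABrs.sub, AVal.sub]
    refine (APlus.scase rfl rfl).trans ?_
    exact APlus.scase rfl rfl
  | i + 1, j + 1 => by
    refine (APlus.call₃ _ _ _ _ τ).trans ?_
    simp only [AComp.inst, AComp.sub, ABrs.sub, AVal.sub]
    refine (APlus.scase rfl rfl).trans ?_
    simp only [AComp.inst, AComp.sub, ABrs.sub, AVal.sub]
    refine (APlus.scase (N := compareLoop (num i) (num j)) rfl ?_).trans ?_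
    · simp [AComp.inst, AComp.sub, AVal.sub, AVal.ren, compareLoop]
    · have : compareTag (i + 1) (j + 1) = compareTag i j := by simp [compareTag]
      exact this ▸ compareLoop_run τ i j

theorem compareV_run (i j : ℕ) (τ : AStore) :
    APlus (.conf (.app (.app (.force compareV) (num i)) (num j)) τ)
      (.conf (.ret (.inj (compareTag i j) .unit)) τ) :=
  (APlus.app _ (APlus.app _ (APlus.beta (.force _ τ)))).trans (compareLoop_run τ i j)

theorem failV_run (τ : AStore) : APlus (.conf (.force failV) τ) .bot := by
  obtain ⟨z, hz⟩ := AStore.exists_fresh τ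
  refine (APlus.beta (.force _ τ)).trans (APlus.bind (APlus.beta (.create _ τ z hz)) rfl ?_)
  -- The coroutine finishes without yielding, so its location keeps the `nil` written by the first
  -- resumption; the second resumption then fails.
  refine APlus.bind (M := .resume (.lab z) .unit) (N := .resume (.lab z) .unit) (V := .unit)
    (N' := .resume (.lab z) .unit)
    (τ' := (τ.insert z (.full (.thunk (.lam (.ret .unit))))).insert z .nil) ?_ rfl ?_
  · exact (APlus.beta (.resume z _ _ _ (Finmap.lookup_insert _))).trans
      ((APlus.label z (APlus.call _ _ _)).trans (APlus.beta (.ret z .unit _)))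
  · exact APlus.beta (.fail z _ _ (Finmap.lookup_insert _))

/-! ### Running the macros -/

theorem dollarMacro_run (N₁ N₂ : AComp) {z zc : Label} {τ : AStore} (hz : z ∉ τ)
    (hzc : zc ∉ τ) (hne : zc ≠ z) :
    APlus (.conf (dollarMacro N₁ N₂) τ)
      (.conf (running z zc 0 N₁ N₂)
        ((τ.insert zc (.full (refCell (num 0)))).insert z .nil)) := by
  refine APlus.bind (APlus.beta (.create _ τ z hz))
    (N' := .seq (.app (.force refV) (num 0)) (.seq (.resume (.lab z) .unit)
        (.app (.force (.var 0)) (.pair (.pair (.lab z) (.var 1)) (num 0))))) ?_ ?_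
  · simp [AComp.inst, AComp.sub, AVal.sub, AVal.ren]
  refine APlus.bind (refV_run 0 (l := zc) (by simp [hzc, hne]))
    (N' := .seq (.resume (.lab z) .unit)
        (.app (.force (.var 0)) (triple (z, zc, 0)))) ?_ ?_
  · simp [AComp.inst, AComp.sub, AVal.sub, AVal.ren, triple]
  -- The store is normalised so that the body of the new coroutine, overwritten by `nil` on its
  -- first resumption, disappears from the statement.
  have hτ : ((τ.insert z (.full (.thunk (.lam ((coBody N₁ N₂).ren Nat.succ))))).insert zc
      (.full (refCell (num 0)))).insert z .nil =
      (τ.insert zc (.full (refCell (num 0)))).insert z .nil := by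
    rw [Finmap.insert_insert_of_ne _ hne, AStore.insert_nil_insert,
      Finmap.insert_insert_of_ne _ hne]
  rw [← hτ]
  refine APlus.seq _ (APlus.resume (M := (coBody N₁ N₂).ren Nat.succ) ?_
    (AComp.ren_succ_inst _ _))
  rw [Finmap.lookup_insert_of_ne _ hne.symm, Finmap.lookup_insert]

/-- Common part of normal return and yield: whichever way the coroutine is left, the resulting
function is forced and applied to the name of the coroutine. -/
theorem running_return (m mc : Label) (i : ℕ) {N N' : AComp} {τ τ' : AStore}
    (h : APlus (.conf (.label m N) τ) (.conf (.ret (.thunk (.lam N'))) τ')) :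
    APlus (.conf (.seq (.label m N) (.app (.force (.var 0)) (triple (m, mc, i)))) τ)
      (.conf (N'.inst (triple (m, mc, i))) τ') := by
  refine APlus.bind h (N' := .app (.force (.thunk (.lam N'))) (triple (m, mc, i))) ?_
    (APlus.call _ _ _)
  simp [AComp.inst, AComp.sub, AVal.sub]

theorem running_ret (m mc : Label) (i : ℕ) (V : AVal) (N : AComp) (τ : AStore) :
    APlus (.conf (running m mc i (.ret V) N) τ) (.conf (N.inst V) τ) := by
  have : (N.ren Nat.succ).sub (AVal.up (scons V AVal.var)) = (N.inst V).ren Nat.succ :=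
    AComp.ren_succ_sub_up _ _
  -- The returned function discards the name, so its body is a weakened term that is instantiated
  -- again.
  rw [← AComp.ren_succ_inst (N.inst V) (triple (m, mc, i)), ← this]
  exact running_return m mc i ((APlus.label m (APlus.beta (.seq V _ τ))).trans
    (APlus.beta (.ret m _ τ)))

/-- The frame `x ← [ ]; return {λ_. N}` lies inside the label and is pure, so it is captured along
with `H`. The number `i` handed out is the one recorded in the waiting frame. -/
theorem running_yield (m mc : Label) (i : ℕ) (H : APCtx) (M N : AComp) (τ : AStore) :
    APlus (.conf (running m mc i (H.plug (.yield (.thunk (.lam M)))) N) τ)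
      (.conf (M.inst (triple (m, mc, i)))
        (τ.insert m (.full (APCtx.seq H (.ret (.thunk (.lam (N.ren Nat.succ))))).reify))) :=
  running_return m mc i
    (APlus.beta (.yield m (.seq H (.ret (.thunk (.lam (N.ren Nat.succ))))) _ τ))

/-- Resuming a reified context gives the context back: `y` occurs only in the hole, and the
weakening of `H` is undone. -/
theorem APCtx.ren_succ_plug_inst (H : APCtx) (W : AVal) :
    ((H.ren Nat.succ).plug (.ret (.var 0))).inst W = H.plug (.ret W) := by
  induction H with
  | hole => rfl
  | seq H N ih =>
    have := AComp.ren_sub (liftR Nat.succ) (AVal.up (scons W AVal.var)) N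
    rw [AVal.up_liftR] at this
    simp_all [APCtx.ren, APCtx.plug, AComp.inst, AComp.sub]
  | app H V ih => simp_all [APCtx.ren, APCtx.plug, AComp.inst, AComp.sub, AVal.ren_sub]
  | prj i H ih => simp_all [APCtx.ren, APCtx.plug, AComp.inst, AComp.sub]

/-- The program `throwMacro` after the content `j` of the counter has been compared with `i`
and the comparison has been resolved to `b`. -/
def throwBranches (z zc : Label) (i : ℕ) (b W : AVal) : AComp :=
  .scase b
    (.cons tagTrue
      (.seq (.app (.force incrV) (num i))
        (.seq (.app (.app (.force setV) (.lab zc)) (.var 0))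
          (.seq (.resume (.lab z) (W.ren (fun n => n + 3)))
            (.app (.force (.var 0)) (.pair (.pair (.lab z) (.lab zc)) (.var 2))))))
    (.cons tagFalse (.force failV) .nil))

theorem throwMacro_compare {z zc : Label} {i j : ℕ} (W : AVal) {τ : AStore}
    (hc : GetNum zc τ j) :
    APlus (.conf (throwMacro (triple (z, zc, i)) W) τ)
      (.conf (throwBranches z zc i (.inj (compareTag i j) .unit) W) τ) := by
  -- The weakening of `W` counts the binders still around it: nine in the macro, two fewer after
  -- each pair pattern, and one fewer after each `let`. `throwBranches` itself accounts for three of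
  -- them.
  refine (APlus.pcase (N := .pcase (.pair (.lab z) (.lab zc))
    (.seq (.app (.force getV) (.var 0))
      (.seq (.app (.app (.force compareV) (num i)) (.var 0))
        (.scase (.var 0)
          (.cons tagTrue
            (.seq (.app (.force incrV) (num i))
              (.seq (.app (.app (.force setV) (.var 4)) (.var 0))
                (.seq (.resume (.var 6) (W.ren (fun n => n + 7)))
                  (.app (.force (.var 0))
                    (.pair (.pair (.var 7) (.var 6)) (.var 2))))))
          (.cons tagFalse (.force failV) .nil)))))) ?_).trans ?_
  · simp [AComp.inst2, AComp.sub, ABrs.sub, AVal.sub, AVal.ren, AVal.ren_sub, AVal.sub_var_comp]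
  refine (APlus.pcase (N := .seq (.app (.force getV) (.lab zc))
      (.seq (.app (.app (.force compareV) (num i)) (.var 0))
        (throwBranches z zc i (.var 0) (W.ren (fun n => n + 2))))) ?_).trans ?_
  · simp [AComp.inst2, AComp.sub, ABrs.sub, AVal.sub, AVal.ren, AVal.ren_sub, AVal.sub_var_comp,
      AVal.ren_ren, throwBranches]
  refine APlus.bind (getV_run hc) (N' := .seq (.app (.app (.force compareV) (num i)) (num j))
        (throwBranches z zc i (.var 0) (W.ren Nat.succ))) ?_ ?_
  · simp [AComp.inst, AComp.sub, ABrs.sub, AVal.sub, AVal.ren, AVal.ren_sub, AVal.sub_var_comp,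
      AVal.ren_ren, throwBranches]
  refine APlus.bindRet (compareV_run i j τ) ?_
  simp [AComp.inst, AComp.sub, ABrs.sub, AVal.sub, AVal.ren, AVal.ren_sub, AVal.sub_var_comp,
      AVal.ren_ren, throwBranches]

theorem throwMacro_run {z zc : Label} {i : ℕ} (H : APCtx) (N : AComp) (W : AVal) {τ : AStore}
    (hc : GetNum zc τ i) (hne : zc ≠ z) (hz : τ.lookup z = some
      (.full (APCtx.seq H (.ret (.thunk (.lam (N.ren Nat.succ))))).reify)) :
    APlus (.conf (throwMacro (triple (z, zc, i)) W) τ)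
      (.conf (running z zc (i + 1) (H.plug (.ret W)) N)
        ((τ.insert zc (.full (refCell (num (i + 1))))).insert z .nil)) := by
  refine (throwMacro_compare W hc).trans ?_
  rw [compareTag, if_pos rfl]
  refine (APlus.scase (N := .seq (.app (.force incrV) (num i))
        (.seq (.app (.app (.force setV) (.lab zc)) (.var 0))
          (.seq (.resume (.lab z) (W.ren (fun n => n + 2)))
            (.app (.force (.var 0)) (.pair (.pair (.lab z) (.lab zc)) (.var 2)))))) rfl ?_).trans ?_
  · simp [AComp.inst, AComp.sub, AVal.sub, AVal.ren, AVal.ren_sub, AVal.sub_var_comp]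
  refine APlus.bind (incrV_run i τ)
    (N' := .seq (.app (.app (.force setV) (.lab zc)) (num (i + 1)))
          (.seq (.resume (.lab z) (W.ren Nat.succ))
            (.app (.force (.var 0)) (triple (z, zc, i + 1))))) ?_ ?_
  · simp [AComp.inst, AComp.sub, AVal.sub, AVal.ren, AVal.ren_sub, AVal.sub_var_comp, triple]
  refine APlus.bind (setV_run (i + 1) hc)
    (N' := .seq (.resume (.lab z) W) (.app (.force (.var 0)) (triple (z, zc, i + 1)))) ?_ ?_
  · simp [AComp.inst, AComp.sub, AVal.sub, AVal.ren_sub]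
  -- The resumed context includes the frame that wraps `N`, so what runs under the label is the body
  -- of a running delimiter. The incremented number matches the new content of the counter.
  refine APlus.seq _ (APlus.resume ?_ (APCtx.ren_succ_plug_inst
    (.seq H (.ret (.thunk (.lam (N.ren Nat.succ))))) W))
  rwa [Finmap.lookup_insert_of_ne _ hne.symm]

theorem throwMacro_fail {z zc : Label} {i j : ℕ} (W : AVal) {τ : AStore}
    (hc : GetNum zc τ j) (hij : i ≠ j) :
    APlus (.conf (throwMacro (triple (z, zc, i)) W) τ) .bot := by
  refine (throwMacro_compare W hc).trans ?_
  rw [compareTag, if_neg hij]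
  exact (APlus.scase (N := .force failV) rfl rfl).trans (failV_run τ)

/-! ### Translated terms and contexts -/

/-- The context `let res = m : (x ← D[ ]; return {λ_. N}) in res! ((m, mc), i)`. -/
def ACtx.running (m mc : Label) (i : ℕ) (D : ACtx) (N : AComp) : ACtx :=
  .seq (.label m (.seq D (.ret (.thunk (.lam (N.ren Nat.succ))))))
    (.app (.force (.var 0)) (triple (m, mc, i)))

theorem AStar.running (m mc : Label) (i : ℕ) {M M' : AComp} {τ τ' : AStore} (N : AComp)
    (h : AStar (.conf M τ) (.conf M' τ')) :
    AStar (.conf (running m mc i M N) τ) (.conf (running m mc i M' N) τ') :=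
  h.inCtx (.running m mc i .hole N)

/-- The labels in `L` are those of the running coroutines around the hole: the relation of `Rel`
for evaluation contexts all of whose delimiters are running. -/
inductive CtxRel (η : Env) (κ : Label → Option Label) (θ : DStore) (τ : AStore) :
    DCtx → ACtx → Set Label → Prop
  | hole : CtxRel η κ θ τ .hole .hole ∅
  | seq {C D L M N} : CtxRel η κ θ τ C D L → TrComp η M N →
      CtxRel η κ θ τ (.seq C M) (.seq D N) L
  | app {C D L V W} : CtxRel η κ θ τ C D L → TrVal η V W →
      CtxRel η κ θ τ (.app C V) (.app D W) L
  | prj {C D L i} : CtxRel η κ θ τ C D L → CtxRel η κ θ τ (.prj i C) (.prj i D) L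
  | running {C D L M N m mc i} : CtxRel η κ θ τ C D L → TrComp η M N → m ∉ L →
      κ m = some mc → GetNum mc τ i → τ.lookup m = some .nil →
      (∀ l j, η l = some (m, mc, j) → θ.lookup l = some .nil) →
      CtxRel η κ θ τ (.dollar C M) (.running m mc i D N) (insert m L)

/-- Only sequencing, application and projection need recursion; every other form, delimiters
included, has a clause for its plain translation. The stores and `κ` play no role. -/
theorem Rel.of_tr {η : Env} {κ : Label → Option Label} {θ : DStore} {τ : AStore} :
    ∀ {M : DComp}, M.labels ⊆ pdom η → Rel η κ θ τ M (M.tr η)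
  | .pcase _ _, h => .pcase ⟨h, rfl⟩
  | .scase _ _, h => .scase ⟨h, rfl⟩
  | .force _, h => .force ⟨h, rfl⟩
  | .ret _, h => .ret ⟨h, rfl⟩
  | .seq _ _, h => have h := Set.union_subset_iff.1 h; .seq (.of_tr h.1) ⟨h.2, rfl⟩
  | .lam _, h => .lam ⟨h, rfl⟩
  | .app _ _, h => have h := Set.union_subset_iff.1 h; .app (.of_tr h.1) ⟨h.2, rfl⟩
  | .cpair _ _, h => .cpair ⟨h, rfl⟩
  | .prj _ M, h => .prj (.of_tr (M := M) h)
  | .shift _, h => .shift ⟨h, rfl⟩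
  | .dollar _ _, h => .dollar ⟨h, rfl⟩
  | .throw _ _, h => .throw ⟨h, rfl⟩

section CtxRel

variable {η : Env} {κ : Label → Option Label} {θ : DStore} {τ : AStore} {C : DCtx} {D : ACtx}
  {L : Set Label}

theorem CtxRel.plug (h : CtxRel η κ θ τ C D L) {M : DComp} {N : AComp}
    (hM : Rel η κ θ τ M N) : Rel η κ θ τ (C.plug M) (D.plug N) := by
  induction h with
  | hole => exact hM
  | seq _ hN ih => exact .seq ih hN
  | app _ hV ih => exact .app ih hV
  | prj _ ih => exact .prj ih
  | running _ hN _ hκ hc hm hl ih => exact .running ih hN hκ hc hm hl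

/-- This makes the side condition `m ∉ L` of a running frame coincide with the condition of
well-formedness on labelled computations. -/
theorem CtxRel.active (h : CtxRel η κ θ τ C D L) {N : AComp} (hN : N.active = ∅) :
    (D.plug N).active = L := by
  induction h with
  | hole => exact hN
  | seq _ h ih => simp [ACtx.plug, AComp.active, ih, h.2]
  | app _ h ih => simp [ACtx.plug, AComp.active, ih, h.2]
  | prj _ ih => exact ih
  | running _ h _ _ _ _ _ ih =>
    simp [ACtx.running, ACtx.plug, AComp.active, AVal.active, ih, h.2]

theorem CtxRel.wf (h : CtxRel η κ θ τ C D L) {N : AComp} (hN : N.active = ∅) (hw : N.WF) :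
    (D.plug N).WF := by
  induction h with
  | hole => exact hw
  | seq _ h ih => exact .seq ih (by simp [h.2])
  | app _ h ih => exact .app ih (by simp [h.2])
  | prj _ ih => exact .prj ih
  | running hC h hm _ _ _ _ ih =>
    refine .seq (.label (.seq ih (by simp [h.2, AComp.active, AVal.active])) ?_)
      (by simp [AComp.active, AVal.active])
    simpa [ACtx.plug, AComp.active, AVal.active, h.2, hC.active hN] using hm

theorem CtxRel.lookup (h : CtxRel η κ θ τ C D L) : ∀ m ∈ L, τ.lookup m = some .nil := by
  induction h with
  | hole => simp
  | seq _ _ ih => exact ih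
  | app _ _ ih => exact ih
  | prj _ ih => exact ih
  | running _ _ _ _ _ hm _ ih =>
    rintro m (rfl | h)
    exacts [hm, ih m h]

/-- The frame property. The context sees the stores only through the coroutines in `L`, their
counters and the source labels attached to them, so the conditions have to be transported for these
alone; translated parts survive any extension of `η`. -/
theorem CtxRel.mono {η' : Env} {κ' : Label → Option Label} {θ' : DStore} {τ' : AStore}
    (h : CtxRel η κ θ τ C D L) (hη : ∀ l t, η l = some t → η' l = some t)
    (hf : ∀ m mc i, m ∈ L → κ m = some mc → GetNum mc τ i → τ.lookup m = some .nil →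
      (∀ l j, η l = some (m, mc, j) → θ.lookup l = some .nil) →
      κ' m = some mc ∧ GetNum mc τ' i ∧ τ'.lookup m = some .nil ∧
      ∀ l j, η' l = some (m, mc, j) → θ'.lookup l = some .nil) :
    CtxRel η' κ' θ' τ' C D L := by
  have hd : pdom η ⊆ pdom η' := fun l ⟨t, ht⟩ => ⟨t, hη l t ht⟩
  have hη' : ∀ l ∈ pdom η, η l = η' l := fun l ⟨t, ht⟩ => by rw [ht, hη l t ht]
  have htr : ∀ {M N}, TrComp η M N → TrComp η' M N := fun h =>
    ⟨h.1.trans hd, h.2.trans (DComp.tr_congr fun l hl => hη' l (h.1 hl))⟩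
  have htrV : ∀ {V W}, TrVal η V W → TrVal η' V W := fun h =>
    ⟨h.1.trans hd, h.2.trans (DVal.tr_congr fun l hl => hη' l (h.1 hl))⟩
  induction h with
  | hole => exact .hole
  | seq _ h ih => exact .seq (ih hf) (htr h)
  | app _ h ih => exact .app (ih hf) (htrV h)
  | prj _ ih => exact .prj (ih hf)
  | @running _ _ _ _ _ m mc i _ h hm hκ hc hn hl ih =>
    obtain ⟨h1, h2, h3, h4⟩ := hf m mc i (Set.mem_insert m _) hκ hc hn hl
    exact .running (ih fun m mc i hm => hf m mc i (Set.mem_insert_of_mem _ hm)) (htr h) hm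
      h1 h2 h3 h4

end CtxRel

-- Composition of contexts, and pure contexts as evaluation contexts.

/-- Composition of evaluation contexts. -/
def DCtx.comp : DCtx → DCtx → DCtx
  | .hole, E => E
  | .seq C N, E => .seq (C.comp E) N
  | .app C V, E => .app (C.comp E) V
  | .prj i C, E => .prj i (C.comp E)
  | .dollar C N, E => .dollar (C.comp E) N

theorem DCtx.plug_comp (C E : DCtx) (M : DComp) : (C.comp E).plug M = C.plug (E.plug M) := by
  induction C <;> simp_all [DCtx.comp, DCtx.plug]

/-- Pure contexts are evaluation contexts. -/
def DPCtx.toCtx : DPCtx → DCtx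
  | .hole => .hole
  | .seq H N => .seq H.toCtx N
  | .app H V => .app H.toCtx V
  | .prj i H => .prj i H.toCtx

theorem DPCtx.toCtx_plug (H : DPCtx) (M : DComp) : H.toCtx.plug M = H.plug M := by
  induction H <;> simp_all [DPCtx.toCtx, DPCtx.plug, DCtx.plug]

/-- Pure contexts of `AC` are evaluation contexts. -/
def APCtx.toCtx : APCtx → ACtx
  | .hole => .hole
  | .seq H N => .seq H.toCtx N
  | .app H V => .app H.toCtx V
  | .prj i H => .prj i H.toCtx

theorem APCtx.toCtx_plug (H : APCtx) (M : AComp) : H.toCtx.plug M = H.plug M := by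
  induction H <;> simp_all [APCtx.toCtx, APCtx.plug, ACtx.plug]

theorem DPCtx.plug_tr (η : Env) (H : DPCtx) (M : DComp) :
    (H.plug M).tr η = (H.tr η).plug (M.tr η) := by
  induction H <;> simp_all [DPCtx.tr, DPCtx.plug, APCtx.plug, DComp.tr]

theorem DPCtx.labels_plug {S : Set Label} {H : DPCtx} {M : DComp} (hH : H.labels ⊆ S)
    (hM : M.labels ⊆ S) : (H.plug M).labels ⊆ S := by
  induction H with
  | hole => exact hM
  | seq H N ih =>
    have := Set.union_subset_iff.1 hH
    exact Set.union_subset (ih this.1) this.2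
  | app H V ih =>
    have := Set.union_subset_iff.1 hH
    exact Set.union_subset (ih this.1) this.2
  | prj i H ih => exact ih hH

@[simp] theorem DPCtx.tr_ren_plug_active (η : Env) (ρ : ℕ → ℕ) (H : DPCtx) (N : AComp) :
    (((H.tr η).ren ρ).plug N).active = N.active := by
  induction H <;> simp_all [DPCtx.tr, APCtx.ren, APCtx.plug, AComp.active]

section CtxRel

variable {η : Env} {κ : Label → Option Label} {θ : DStore} {τ : AStore} {D : ACtx}
  {L : Set Label}

theorem CtxRel.comp_inv {C E : DCtx} (h : CtxRel η κ θ τ (C.comp E) D L) :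
    ∃ D₁ D₂ L₁ L₂, CtxRel η κ θ τ C D₁ L₁ ∧ CtxRel η κ θ τ E D₂ L₂ ∧ D = D₁.comp D₂ ∧
      Disjoint L₁ L₂ := by
  -- The equation `L = L₁ ∪ L₂` is added for the induction: at a running frame, `m ∉ L` must give
  -- both `m ∉ L₁` and `m ∉ L₂`.
  have : ∃ D₁ D₂ L₁ L₂, CtxRel η κ θ τ C D₁ L₁ ∧ CtxRel η κ θ τ E D₂ L₂ ∧ D = D₁.comp D₂ ∧
      Disjoint L₁ L₂ ∧ L = L₁ ∪ L₂ := by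
    induction C generalizing D L with
    | hole => exact ⟨.hole, D, ∅, L, .hole, h, rfl, by simp, by simp⟩
    | seq C N ih =>
      cases h with
      | seq h hN =>
        obtain ⟨D₁, D₂, L₁, L₂, h₁, h₂, rfl, hd, hL⟩ := ih h
        exact ⟨_, D₂, L₁, L₂, .seq h₁ hN, h₂, rfl, hd, hL⟩
    | app C V ih =>
      cases h with
      | app h hN =>
        obtain ⟨D₁, D₂, L₁, L₂, h₁, h₂, rfl, hd, hL⟩ := ih h
        exact ⟨_, D₂, L₁, L₂, .app h₁ hN, h₂, rfl, hd, hL⟩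
    | prj i C ih =>
      cases h with
      | prj h =>
        obtain ⟨D₁, D₂, L₁, L₂, h₁, h₂, rfl, hd, hL⟩ := ih h
        exact ⟨_, D₂, L₁, L₂, .prj h₁, h₂, rfl, hd, hL⟩
    | dollar C N ih =>
      cases h with
      | running h hN hm hκ hc hn hl =>
        obtain ⟨D₁, D₂, L₁, L₂, h₁, h₂, rfl, hd, rfl⟩ := ih h
        refine ⟨_, D₂, _, L₂, .running h₁ hN (fun h => hm (.inl h)) hκ hc hn hl, h₂, rfl, ?_,
          (Set.insert_union ..).symm⟩
        exact Set.disjoint_insert_left.2 ⟨fun h => hm (.inr h), hd⟩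
  obtain ⟨D₁, D₂, L₁, L₂, h₁, h₂, h₃, h₄, -⟩ := this
  exact ⟨D₁, D₂, L₁, L₂, h₁, h₂, h₃, h₄⟩

theorem CtxRel.comp {C E : DCtx} {D₁ D₂ : ACtx} {L₁ L₂ : Set Label}
    (h : CtxRel η κ θ τ C D₁ L₁) (h' : CtxRel η κ θ τ E D₂ L₂) (hd : Disjoint L₁ L₂) :
    CtxRel η κ θ τ (C.comp E) (D₁.comp D₂) (L₁ ∪ L₂) := by
  induction h with
  | hole => rwa [Set.empty_union]
  | seq _ h ih => exact .seq (ih hd) h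
  | app _ h ih => exact .app (ih hd) h
  | prj _ ih => exact .prj (ih hd)
  | running _ h hm hκ hc hn hl ih =>
    have hd := Set.disjoint_insert_left.1 hd
    rw [Set.insert_union]
    exact .running (ih hd.2) h (fun h => h.elim hm hd.1) hκ hc hn hl

/-- Without delimiter frames, every frame is a plain translation and no coroutine runs. -/
theorem CtxRel.pure_inv {H : DPCtx} (h : CtxRel η κ θ τ H.toCtx D L) :
    H.labels ⊆ pdom η ∧ D = (H.tr η).toCtx ∧ L = ∅ := by
  induction H generalizing D with
  | hole => cases h; exact ⟨Set.empty_subset _, rfl, rfl⟩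
  | seq H N ih =>
    cases h with
    | seq h hN =>
      obtain ⟨h₁, rfl, h₂⟩ := ih h
      exact ⟨Set.union_subset h₁ hN.1, by rw [hN.2]; rfl, h₂⟩
  | app H V ih =>
    cases h with
    | app h hN =>
      obtain ⟨h₁, rfl, h₂⟩ := ih h
      exact ⟨Set.union_subset h₁ hN.1, by rw [hN.2]; rfl, h₂⟩
  | prj i H ih =>
    cases h with
    | prj h =>
      obtain ⟨h₁, rfl, h₂⟩ := ih h
      exact ⟨h₁, rfl, h₂⟩

end CtxRel

-- Well-formedness and reassembly of similar configurations.

/-- No value stored in `τ` has active labels. -/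
def StoreInactive (τ : AStore) : Prop := ∀ l V, τ.lookup l = some (.full V) → V.active = ∅

theorem StoreInactive.insert {τ : AStore} (h : StoreInactive τ) {l : Label} {s : Slot AVal}
    (hs : ∀ V, s = .full V → V.active = ∅) : StoreInactive (τ.insert l s) := by
  intro m V hm
  by_cases hml : m = l
  · subst hml
    rw [Finmap.lookup_insert] at hm
    exact hs V (Option.some.inj hm)
  · rw [Finmap.lookup_insert_of_ne _ hml] at hm
    exact h m V hm

theorem AComp.WF.of_active {N : AComp} (h : N.active = ∅) : N.WF := by
  induction N using AComp.rec (motive_1 := fun _ => True) (motive_3 := fun _ => True) with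
  | pcase _ _ => exact .pcase h
  | scase _ _ => exact .scase h
  | force _ => exact .force h
  | ret _ => exact .ret h
  | seq M N ihM _ => exact .seq (ihM (Set.union_empty_iff.1 h).1) (Set.union_empty_iff.1 h).2
  | lam _ => exact .lam h
  | app M V ihM _ => exact .app (ihM (Set.union_empty_iff.1 h).1) (Set.union_empty_iff.1 h).2
  | cpair _ _ => exact .cpair h
  | prj _ _ ih => exact .prj (ih h)
  | label l M _ => exact absurd h (Set.insert_nonempty l M.active).ne_empty
  | create _ => exact .create h
  | resume _ _ => exact .resume h
  | yield _ => exact .yield h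
  | _ => trivial

/-- A related context around related active-free computations gives similar configurations. -/
theorem CtxRel.sim {η : Env} {κ : Label → Option Label} {θ : DStore} {τ : AStore} {C : DCtx}
    {D : ACtx} {L : Set Label} (h : CtxRel η κ θ τ C D L) {M : DComp} (hM : M.labels ⊆ pdom η)
    (hτ : StoreInactive τ) (hI : IC θ τ η κ) :
    Sim (.conf (C.plug M) θ) (.conf (D.plug (M.tr η)) τ) :=
  have ha := DComp.tr_active η M
  .inr ⟨_, _, θ, τ, η, κ, rfl, rfl, h.plug (.of_tr hM),
    ⟨h.wf ha (.of_active ha), hτ, fun l hl => h.lookup l (h.active ha ▸ hl)⟩, hI⟩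

/-! ### The invariant -/

theorem num_injective : Function.Injective num := by
  intro i
  induction i with
  | zero => intro j h; cases j <;> simp_all [num, tagZero, tagSucc]
  | succ i ih =>
    intro j h
    cases j with
    | zero => simp [num, tagZero, tagSucc] at h
    | succ j => simp only [num, AVal.inj.injEq, true_and] at h; rw [ih h]

/-- The content can be read off the stored code because numerals are distinct terms. This identifies
the existentially given counter value of `IC.used` with a known one. -/
theorem GetNum.unique {l : Label} {τ : AStore} {i j : ℕ} (hi : GetNum l τ i)
    (hj : GetNum l τ j) : i = j := by
  have h := hi.symm.trans hj
  simp only [refCell, num_ren, Option.some.injEq, Slot.full.injEq, AVal.thunk.injEq,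
    AComp.lam.injEq, AComp.seq.injEq, AComp.app.injEq, true_and, and_true] at h
  exact num_injective h

theorem GetNum.insert {l m : Label} {τ : AStore} {i : ℕ} (h : GetNum l τ i) (hlm : l ≠ m)
    (s : Slot AVal) : GetNum l (τ.insert m s) i := by
  rwa [GetNum, Finmap.lookup_insert_of_ne _ hlm]

theorem GetNum.insert_self (l : Label) (τ : AStore) (i : ℕ) :
    GetNum l (τ.insert l (.full (refCell (num i)))) i :=
  Finmap.lookup_insert _

theorem lookup_insert_of_fresh {τ : AStore} {l m : Label} {s s' : Slot AVal} (hl : l ∉ τ)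
    (h : τ.lookup m = some s) : (τ.insert l s').lookup m = some s := by
  rwa [Finmap.lookup_insert_of_ne]
  rintro rfl
  exact hl (Finmap.mem_of_lookup_eq_some h)

section IC

variable {θ : DStore} {τ : AStore} {η : Env} {κ : Label → Option Label}

theorem IC.mem (h : IC θ τ η κ) {z zc : Label} (hz : κ z = some zc) : z ∈ τ ∧ zc ∈ τ := by
  have := h.kappa_dom
  exact ⟨this.subset (.inl ⟨zc, hz⟩), this.subset (.inr ⟨z, hz⟩)⟩

/-- Counters and coroutines occupy disjoint locations, so writing to one kind never touches the
other. -/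
theorem IC.ne (h : IC θ τ η κ) {z zc m mc : Label} (hz : κ z = some zc) (hm : κ m = some mc) :
    mc ≠ z := by
  rintro rfl
  have : mc ∈ pdom κ ∩ pim κ := ⟨⟨zc, hz⟩, ⟨m, hm⟩⟩
  rw [h.kappa_disjoint] at this
  exact this

theorem IC.eta_none (h : IC θ τ η κ) {l : Label} (hl : l ∉ θ) : η l = none := by
  cases ht : η l with
  | none => rfl
  | some t => exact absurd (h.eta_dom.subset ⟨t, ht⟩) hl

/-- Creating a coroutine together with its counter. -/
theorem IC.create (h : IC θ τ η κ) {z zc : Label} (hz : z ∉ τ) (hzc : zc ∉ τ) (hne : zc ≠ z)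
    (s s' : Slot AVal) :
    IC θ ((τ.insert zc s).insert z s') η (Function.update κ z (some zc)) := by
  -- Both new locations are fresh, so every old entry survives. As `η` does not mention them, their
  -- contents `s` and `s'` are arbitrary.
  have hτ : ∀ {m t}, τ.lookup m = some t → ((τ.insert zc s).insert z s').lookup m = some t :=
    fun hm => lookup_insert_of_fresh (by simp [hz, hne.symm]) (lookup_insert_of_fresh hzc hm)
  have hdom : pdom (Function.update κ z (some zc)) = insert z (pdom κ) := by
    ext m
    by_cases hm : m = z
    · subst hm; simp [pdom]
    · simp [pdom, hm]
  have him : pim (Function.update κ z (some zc)) = insert zc (pim κ) := by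
    ext c
    constructor
    · rintro ⟨m, hm⟩
      by_cases hmz : m = z
      · subst hmz; simp at hm; exact .inl hm.symm
      · rw [Function.update_of_ne hmz] at hm; exact .inr ⟨m, hm⟩
    · rintro (rfl | ⟨m, hm⟩)
      · exact ⟨z, by simp⟩
      · refine ⟨m, ?_⟩
        rw [Function.update_of_ne]
        · exact hm
        · rintro rfl; exact hz (h.mem hm).1
  constructor
  · intro m m' c hm hm'
    by_cases h₁ : m = z <;> by_cases h₂ : m' = z
    · rw [h₁, h₂]
    · subst h₁
      rw [Function.update_self] at hm
      rw [Function.update_of_ne h₂] at hm'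
      cases hm
      exact absurd (h.mem hm').2 hzc
    · subst h₂
      rw [Function.update_self] at hm'
      rw [Function.update_of_ne h₁] at hm
      cases hm'
      exact absurd (h.mem hm).2 hzc
    · rw [Function.update_of_ne h₁] at hm
      rw [Function.update_of_ne h₂] at hm'
      exact h.kappa_inj m m' c hm hm'
  · rw [hdom, him, Set.eq_empty_iff_forall_notMem]
    rintro m ⟨rfl | ⟨c, hm⟩, hm' | ⟨m', hm'⟩⟩
    · exact hne hm'.symm
    · exact hz (h.mem hm').2
    · subst hm'; exact hzc (h.mem hm).1
    · exact h.ne hm hm' rfl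
  · rw [hdom, him]
    ext m
    have := Set.ext_iff.1 h.kappa_dom m
    simp only [Set.mem_union, Set.mem_ofPred_eq] at this
    simp only [Set.mem_union, Set.mem_insert_iff, Set.mem_ofPred_eq, Finmap.mem_insert, ← this]
    tauto
  · exact h.eta_dom
  · intro l z' zc' i hl
    have := h.eta_kappa l z' zc' i hl
    rw [Function.update_of_ne]
    · exact this
    · rintro rfl; exact hz (h.mem this).1
  · intro l z' zc' i hl hn
    obtain ⟨j, hj, hij⟩ := h.used l z' zc' i hl hn
    exact ⟨j, hτ hj, hij⟩
  · intro l z' zc' i H M hl hf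
    obtain ⟨h₁, h₂, h₃, K, N, hK, hN, h₄⟩ := h.live l z' zc' i H M hl hf
    exact ⟨h₁, hτ h₂, h₃, K, N, hK, hN, hτ h₄⟩

theorem setOf_mem_insert {α : Type} (θ : Finmap fun _ : Label => Slot α) (l : Label)
    (s : Slot α) : {m | m ∈ θ.insert l s} = insert l {m | m ∈ θ} := by
  ext m; simp

theorem setOf_mem_insert_of_mem {α : Type} {θ : Finmap fun _ : Label => Slot α} {l : Label}
    (hl : l ∈ θ) (s : Slot α) : {m | m ∈ θ.insert l s} = {m | m ∈ θ} := by
  rw [setOf_mem_insert, Set.insert_eq_of_mem (show l ∈ {m | m ∈ θ} from hl)]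

/-- Throwing to a captured continuation. -/
theorem IC.throw (h : IC θ τ η κ) {l z zc : Label} {i : ℕ} {H : DPCtx} {M : DComp}
    (hl : η l = some (z, zc, i)) (hθ : θ.lookup l = some (.full ⟨H, M⟩)) :
    IC (θ.insert l .nil) ((τ.insert zc (.full (refCell (num (i + 1))))).insert z .nil) η κ := by
  have hκ := h.eta_kappa l z zc i hl
  have hne := h.ne hκ hκ
  have hmem := h.mem hκ
  obtain ⟨-, hget, hothers, -⟩ := h.live l z zc i H M hl hθ
  constructor
  · exact h.kappa_inj
  · exact h.kappa_disjoint
  · rw [setOf_mem_insert_of_mem, setOf_mem_insert_of_mem hmem.2, h.kappa_dom]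
    simp [hmem.1]
  · rw [setOf_mem_insert_of_mem (Finmap.mem_of_lookup_eq_some hθ), h.eta_dom]
  · exact h.eta_kappa
  · intro l' z' zc' i' hl' hn
    have hκ' := h.eta_kappa l' z' zc' i' hl'
    by_cases hll : l' = l
    · subst hll
      rw [hl] at hl'
      cases hl'
      exact ⟨i + 1, (GetNum.insert_self zc τ _).insert hne _, Nat.lt_succ_self i⟩
    · rw [Finmap.lookup_insert_of_ne _ hll] at hn
      obtain ⟨j, hj, hij⟩ := h.used l' z' zc' i' hl' hn
      -- Another spent label with the same counter has a number below the old content, which is `i`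
      -- by uniqueness, and hence below `i + 1`.
      by_cases hc : zc' = zc
      · subst hc
        exact ⟨i + 1, (GetNum.insert_self zc' τ _).insert hne _,
          (hget.unique hj ▸ hij).trans (Nat.lt_succ_self i)⟩
      · exact ⟨j, (hj.insert hc _).insert (h.ne hκ hκ') _, hij⟩
  · intro l' z' zc' i' H' M' hl' hf
    have hκ' := h.eta_kappa l' z' zc' i' hl'
    have hll : l' ≠ l := by
      rintro rfl
      rw [Finmap.lookup_insert] at hf
      cases hf
    rw [Finmap.lookup_insert_of_ne _ hll] at hf
    -- `l` was the only live label of the coroutine `z`. By injectivity of `κ`, no other live label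
    -- depends on either of the two overwritten locations.
    have hz : z' ≠ z := by
      rintro rfl
      have := hothers l' (Finmap.mem_of_lookup_eq_some hf) hll _ _ hl'
      rw [hf] at this
      cases this
    have hc : zc' ≠ zc := by
      rintro rfl
      exact hz (h.kappa_inj _ _ _ hκ' hκ)
    obtain ⟨h₁, h₂, h₃, K, N, hK, hN, h₄⟩ := h.live l' z' zc' i' H' M' hl' hf
    refine ⟨h₁, (h₂.insert hc _).insert (h.ne hκ hκ') _, ?_, K, N, hK, hN, ?_⟩
    · intro l'' hl'' hne'' zc'' i'' hη
      by_cases hll' : l'' = l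
      · subst hll'; exact Finmap.lookup_insert _
      · rw [Finmap.lookup_insert_of_ne _ hll']
        exact h₃ l'' (h.eta_dom.subset ⟨_, hη⟩) hne'' zc'' i'' hη
    · rw [Finmap.lookup_insert_of_ne _ hz, Finmap.lookup_insert_of_ne _ (h.ne hκ' hκ).symm]
      exact h₄

/-- Capturing a continuation in the running coroutine `m`. -/
theorem IC.capture (h : IC θ τ η κ) {l m mc : Label} {i : ℕ} {H : DPCtx} {N : DComp}
    (hl : l ∉ θ) (hκ : κ m = some mc) (hc : GetNum mc τ i)
    (hm : ∀ l j, η l = some (m, mc, j) → θ.lookup l = some .nil) (hH : H.labels ⊆ pdom η)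
    (hN : N.labels ⊆ pdom η) :
    IC (θ.insert l (.full ⟨H, N⟩))
      (τ.insert m (.full (APCtx.seq (H.tr η)
        (.ret (.thunk (.lam ((N.tr η).ren Nat.succ))))).reify))
      (Function.update η l (some (m, mc, i))) κ := by
  have hη := h.eta_none hl
  have hext : ∀ l' ∈ pdom η, η l' = Function.update η l (some (m, mc, i)) l' := by
    rintro l' ⟨t, ht⟩
    rw [Function.update_of_ne]
    rintro rfl
    rw [hη] at ht
    cases ht
  have hdom : pdom (Function.update η l (some (m, mc, i))) = insert l (pdom η) := by
    ext l'
    by_cases hll : l' = l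
    · subst hll; simp [pdom]
    · simp [pdom, hll]
  have hsub : pdom η ⊆ pdom (Function.update η l (some (m, mc, i))) := by
    rw [hdom]; exact Set.subset_insert _ _
  have hTr : ∀ {M N}, TrComp η M N → TrComp (Function.update η l (some (m, mc, i))) M N :=
    fun h => ⟨h.1.trans hsub, h.2.trans (DComp.tr_congr fun l hl => hext l (h.1 hl))⟩
  have hTrP : ∀ {H K}, TrPCtx η H K → TrPCtx (Function.update η l (some (m, mc, i))) H K :=
    fun h => ⟨h.1.trans hsub, h.2.trans (DPCtx.tr_congr fun l hl => hext l (h.1 hl))⟩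
  constructor
  · exact h.kappa_inj
  · exact h.kappa_disjoint
  · rw [setOf_mem_insert_of_mem (h.mem hκ).1, h.kappa_dom]
  · rw [setOf_mem_insert, hdom, h.eta_dom]
  · intro l' z' zc' i' hl'
    by_cases hll : l' = l
    · subst hll
      rw [Function.update_self] at hl'
      cases hl'
      exact hκ
    · rw [Function.update_of_ne hll] at hl'
      exact h.eta_kappa _ _ _ _ hl'
  · intro l' z' zc' i' hl' hn
    have hll : l' ≠ l := by
      rintro rfl
      rw [Finmap.lookup_insert] at hn
      cases hn
    rw [Function.update_of_ne hll] at hl'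
    rw [Finmap.lookup_insert_of_ne _ hll] at hn
    obtain ⟨j, hj, hij⟩ := h.used l' z' zc' i' hl' hn
    exact ⟨j, hj.insert (h.ne hκ (h.eta_kappa _ _ _ _ hl')) _, hij⟩
  · intro l' z' zc' i' H' M' hl' hf
    by_cases hll : l' = l
    · subst hll
      rw [Function.update_self] at hl'
      rw [Finmap.lookup_insert] at hf
      cases hl'
      cases hf
      -- `N` was translatable before the capture, so its labels lie in the old store and differ from
      -- the fresh `l`.
      refine ⟨fun hlN => hl (h.eta_dom.subset (hN hlN)), hc.insert (h.ne hκ hκ) _, ?_, _, _,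
        hTrP ⟨hH, rfl⟩, hTr ⟨hN, rfl⟩, Finmap.lookup_insert _⟩
      intro l'' hl'' hne zc'' i'' hη''
      rw [Function.update_of_ne hne] at hη''
      rw [Finmap.lookup_insert_of_ne _ hne]
      have := h.eta_kappa _ _ _ _ hη''
      rw [hκ] at this
      cases this
      exact hm _ _ hη''
    · rw [Function.update_of_ne hll] at hl'
      rw [Finmap.lookup_insert_of_ne _ hll] at hf
      have hκ' := h.eta_kappa _ _ _ _ hl'
      -- While `m` is running, all labels attached to it are spent; a label that is still live
      -- belongs to a different coroutine.
      have hz : z' ≠ m := by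
        rintro rfl
        rw [hκ] at hκ'
        cases hκ'
        have := hm _ _ hl'
        rw [hf] at this
        cases this
      obtain ⟨h₁, h₂, h₃, K, N', hK, hN', h₄⟩ := h.live l' z' zc' i' H' M' hl' hf
      refine ⟨h₁, h₂.insert (h.ne hκ hκ') _, ?_, K, N', hTrP hK, hTr hN', ?_⟩
      · intro l'' hl'' hne'' zc'' i'' hη''
        by_cases hll' : l'' = l
        · subst hll'
          rw [Function.update_self] at hη''
          cases hη''
          exact absurd rfl hz
        · rw [Function.update_of_ne hll'] at hη''
          rw [Finmap.lookup_insert_of_ne _ hll']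
          exact h₃ l'' (h.eta_dom.subset ⟨_, hη''⟩) hne'' zc'' i'' hη''
      · rwa [Finmap.lookup_insert_of_ne _ hz]

end IC

/-! ### Reaching the hole of an evaluation context -/

/-- Reduce the translated delimiters around the hole until all of them are running. -/
theorem Rel.decompose {η : Env} {θ : DStore} {M : DComp} :
    ∀ (C : DCtx) {κ : Label → Option Label} {τ : AStore} {N : AComp},
    Rel η κ θ τ (C.plug M) N → N.WF → StoreInactive τ → IC θ τ η κ →
    ∃ (D : ACtx) (N' : AComp) (κ' : Label → Option Label) (τ' : AStore) (L : Set Label),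
      AStar (.conf N τ) (.conf (D.plug N') τ') ∧
      (∀ m c, κ m = some c → κ' m = some c) ∧
      (∀ m s, τ.lookup m = some s → τ'.lookup m = some s) ∧
      StoreInactive τ' ∧ IC θ τ' η κ' ∧ CtxRel η κ' θ τ' C D L ∧ Rel η κ' θ τ' M N' ∧
      ∀ l ∈ L, l ∈ N.active ∨ l ∉ τ
  | .hole, κ, τ, N, h, _, hτ, hI =>
    ⟨.hole, N, κ, τ, ∅, .refl, fun _ _ h => h, fun _ _ h => h, hτ, hI, .hole, h, by simp⟩
  | .seq C K, κ, τ, _, h, hw, hτ, hI => by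
    cases h with
    | seq h hK =>
      cases hw with
      | seq hw _ =>
        obtain ⟨D, N', κ', τ', L, h₁, h₂, h₃, h₄, h₅, h₆, h₇, h₈⟩ := Rel.decompose C h hw hτ hI
        exact ⟨.seq D _, N', κ', τ', L, h₁.inCtx (.seq .hole _), h₂, h₃, h₄, h₅, .seq h₆ hK, h₇,
          fun l hl => (h₈ l hl).imp_left .inl⟩
  | .app C V, κ, τ, _, h, hw, hτ, hI => by
    cases h with
    | app h hV =>
      cases hw with
      | app hw _ =>
        obtain ⟨D, N', κ', τ', L, h₁, h₂, h₃, h₄, h₅, h₆, h₇, h₈⟩ := Rel.decompose C h hw hτ hI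
        exact ⟨.app D _, N', κ', τ', L, h₁.inCtx (.app .hole _), h₂, h₃, h₄, h₅, .app h₆ hV, h₇,
          fun l hl => (h₈ l hl).imp_left .inl⟩
  | .prj i C, κ, τ, _, h, hw, hτ, hI => by
    cases h with
    | prj h =>
      cases hw with
      | prj hw =>
        obtain ⟨D, N', κ', τ', L, h₁, h₂, h₃, h₄, h₅, h₆, h₇, h₈⟩ := Rel.decompose C h hw hτ hI
        exact ⟨.prj i D, N', κ', τ', L, h₁.inCtx (.prj i .hole), h₂, h₃, h₄, h₅, .prj h₆, h₇, h₈⟩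
  | .dollar C K, κ, τ, _, h, hw, hτ, hI => by
    cases h with
    | dollar h =>
      obtain ⟨hlab, rfl⟩ := h
      have hlab := Set.union_subset_iff.1 hlab
      obtain ⟨z, hz⟩ := AStore.exists_fresh τ
      -- Freshness for the extended store gives both `zc ∉ τ` and `zc ≠ z`.
      obtain ⟨zc, hzc⟩ := AStore.exists_fresh (τ.insert z .nil)
      rw [Finmap.mem_insert, not_or] at hzc
      obtain ⟨hne, hzc⟩ := hzc
      have ha := DComp.tr_active η (C.plug M)
      obtain ⟨D, N', κ', τ', L, h₁, h₂, h₃, h₄, h₅, h₆, h₇, h₈⟩ :=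
        Rel.decompose C (.of_tr hlab.1) (.of_active ha)
          ((hτ.insert (l := zc) (s := .full (refCell (num 0)))
            (by rintro _ ⟨⟩; simp [refCell_active])).insert
            (l := z) (s := .nil) (by rintro _ ⟨⟩)) (hI.create hz hzc hne _ _)
      refine ⟨.running z zc 0 D (K.tr η), N', κ', τ', insert z L,
        (dollarMacro_run _ (K.tr η) hz hzc hne).to_reflTransGen.trans
          (h₁.running z zc 0 _), ?_, ?_, h₄, h₅,
        .running h₆ ⟨hlab.2, rfl⟩ ?_ (h₂ _ _ (Function.update_self ..))
          (h₃ _ _ ((GetNum.insert_self zc τ 0).insert hne _)) (h₃ _ _ (Finmap.lookup_insert _))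
          ?_, h₇, ?_⟩
      · intro m c hm
        refine h₂ m c ?_
        rwa [Function.update_of_ne]
        rintro rfl
        exact hz (hI.mem hm).1
      · exact fun m s hm => h₃ m s
          (lookup_insert_of_fresh (by simp [hz, Ne.symm hne]) (lookup_insert_of_fresh hzc hm))
      -- The last clause of the conclusion serves this purpose: an inner running label is active in
      -- the translated body, which is impossible, or fresh for a store that already contains `z`.
      · intro hzL
        rcases h₈ z hzL with h | h
        · rw [ha] at h; exact h
        · simp at h
      -- No source label can refer to a coroutine that has just been created.
      · intro l j hl
        exact absurd (hI.mem (hI.eta_kappa _ _ _ _ hl)).1 hz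
      · rintro l (rfl | hl)
        · exact .inr hz
        · rcases h₈ l hl with h | h
          · rw [ha] at h; exact h.elim
          · exact .inr fun hl => h (by simp [hl])
    | @running _ _ N₁ _ m mc i h hK hκ hc hm hl =>
      cases hw with
      | seq hw _ =>
        cases hw with
        | label hw hmN =>
          cases hw with
          | seq hw _ =>
            obtain ⟨D, N', κ', τ', L, h₁, h₂, h₃, h₄, h₅, h₆, h₇, h₈⟩ :=
              Rel.decompose C h hw hτ hI
            refine ⟨.running m mc i D _, N', κ', τ', insert m L, h₁.running m mc i _, h₂, h₃,
              h₄, h₅,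
              .running h₆ hK ?_ (h₂ _ _ hκ) (h₃ _ _ hc) (h₃ _ _ hm) hl, h₇, ?_⟩
            -- Either `m` would be active inside its own body, against well-formedness, or it would
            -- be missing from the store, although it lies in the domain of `κ`.
            · intro hmL
              rcases h₈ m hmL with h | h
              · exact hmN (.inl h)
              · exact h (hI.mem hκ).1
            · rintro l (rfl | hl)
              · exact .inl (.inl (.inl rfl))
              · exact (h₈ l hl).imp_left fun h => .inl (.inr (.inl h))

/-- The hypothesis `hM` asks that the term in the hole have no partner but its translation. It
excludes a delimiter, which may also be running; steps at a delimiter therefore move it into `C`. -/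
theorem Sim.decompose {C : DCtx} {M : DComp} {θ : DStore} {c : AConf}
    (h : Sim (.conf (C.plug M) θ) c)
    (hM : ∀ η κ τ N, Rel η κ θ τ M N → TrComp η M N) :
    ∃ η κ τ D L, AStar c (.conf (D.plug (M.tr η)) τ) ∧ M.labels ⊆ pdom η ∧
      CtxRel η κ θ τ C D L ∧ StoreInactive τ ∧ IC θ τ η κ := by
  rcases h with ⟨h, -⟩ | ⟨M', N, θ', τ, η, κ, hc, rfl, hrel, hwf, hI⟩
  · cases h
  · cases hc
    obtain ⟨D, N', κ', τ', L, h₁, -, -, h₂, h₃, h₄, h₅, -⟩ :=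
      Rel.decompose C hrel hwf.comp hwf.store hI
    obtain ⟨h₆, rfl⟩ := hM _ _ _ _ h₅
    exact ⟨η, κ', τ', D, L, h₁, h₆, h₄, h₂, h₃⟩

/-! ### Simulating the steps -/

/-- The steps that do not change the store. -/
theorem Sim.pure_step {C : DCtx} {M M' : DComp} {θ : DStore} {c : AConf}
    (h : Sim (.conf (C.plug M) θ) c)
    (hM : ∀ η κ τ N, Rel η κ θ τ M N → TrComp η M N)
    (hlab : ∀ S : Set Label, M.labels ⊆ S → M'.labels ⊆ S)
    (hrun : ∀ η τ, APlus (.conf (M.tr η) τ) (.conf (M'.tr η) τ)) :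
    ∃ c', APlus c c' ∧ Sim (.conf (C.plug M') θ) c' := by
  obtain ⟨η, κ, τ, D, L, h₁, h₂, h₃, h₄, h₅⟩ := h.decompose hM
  exact ⟨_, .trans_right h₁ ((hrun η τ).inCtx D), h₃.sim (hlab _ h₂) h₄ h₅⟩

theorem Sim.ret_step {C : DCtx} {V : DVal} {N : DComp} {θ : DStore} {c : AConf}
    (h : Sim (.conf (C.plug (.dollar (.ret V) N)) θ) c) :
    ∃ c', APlus c c' ∧ Sim (.conf (C.plug (N.inst V)) θ) c' := by
  -- The delimiter of the redex is treated as the innermost context frame, which forces its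
  -- coroutine to run before the step is simulated.
  replace h : Sim (.conf ((C.comp (.dollar .hole N)).plug (.ret V)) θ) c := by
    rwa [DCtx.plug_comp]
  obtain ⟨η, κ, τ, D, L, h₁, h₂, h₃, h₄, h₅⟩ := h.decompose
    (fun _ _ _ _ h => by cases h; assumption)
  obtain ⟨D₁, D₂, L₁, L₂, h₆, h₇, rfl, -⟩ := h₃.comp_inv
  cases h₇ with
  | running h hN _ _ _ _ _ =>
    cases h
    refine ⟨_, .trans_right h₁ ?_, h₆.sim (DComp.labels_inst hN.1 h₂) h₄ h₅⟩
    rw [ACtx.plug_comp, DComp.tr_inst, ← hN.2]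
    exact (running_ret _ _ _ (V.tr η) _ τ).inCtx D₁

theorem Sim.shift_step {C : DCtx} {H : DPCtx} {M N : DComp} {θ : DStore} {l : Label} {c : AConf}
    (h : Sim (.conf (C.plug (.dollar (H.plug (.shift M)) N)) θ) c) (hl : l ∉ θ) :
    ∃ c', APlus c c' ∧
      Sim (.conf (C.plug (M.inst (.lab l))) (θ.insert l (.full ⟨H, N⟩))) c' := by
  replace h : Sim (.conf ((C.comp (.dollar H.toCtx N)).plug (.shift M)) θ) c := by
    rwa [DCtx.plug_comp, DCtx.plug, H.toCtx_plug]
  obtain ⟨η, κ, τ, D, L, h₁, h₂, h₃, h₄, h₅⟩ := h.decompose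
    (fun _ _ _ _ h => by cases h; assumption)
  obtain ⟨D₁, D₂, L₁, L₂, h₆, h₇, rfl, hd⟩ := h₃.comp_inv
  cases h₇ with
  | @running _ _ _ _ _ m mc i hH hN _ hκ hc hm hη =>
    obtain ⟨hHl, rfl, rfl⟩ := hH.pure_inv
    obtain ⟨hN, rfl⟩ := hN
    have hηl := h₅.eta_none hl
    have hext : ∀ l' t, η l' = some t → Function.update η l (some (m, mc, i)) l' = some t := by
      intro l' t ht
      rwa [Function.update_of_ne]
      rintro rfl
      rw [hηl] at ht
      cases ht
    have hsub : pdom η ⊆ pdom (Function.update η l (some (m, mc, i))) :=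
      fun l' ⟨t, ht⟩ => ⟨t, hext l' t ht⟩
    have hMtr : M.tr η = M.tr (Function.update η l (some (m, mc, i))) :=
      DComp.tr_congr fun l' hl' => by
        obtain ⟨t, ht⟩ := h₂ hl'
        rw [ht, hext l' t ht]
    -- Running labels are distinct, so the outer delimiters do not use `m` and survive both the
    -- overwriting of its location and the new label attached to it.
    have hmL : m ∉ L₁ := fun h => Set.disjoint_left.1 hd h (Set.mem_insert _ _)
    have hC := h₆.mono (η' := Function.update η l (some (m, mc, i))) (κ' := κ)
      (θ' := θ.insert l (.full ⟨H, N⟩))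
      (τ' := τ.insert m (.full (APCtx.seq (H.tr η)
        (.ret (.thunk (.lam ((N.tr η).ren Nat.succ))))).reify)) hext (by
      intro m' mc' i' hm' hκ' hc' hn' hη'
      have hne : m' ≠ m := fun h => hmL (h ▸ hm')
      refine ⟨hκ', hc'.insert (h₅.ne hκ hκ') _, ?_, ?_⟩
      · rwa [Finmap.lookup_insert_of_ne _ hne]
      · intro l' j hl'
        by_cases hll : l' = l
        · subst hll
          rw [Function.update_self] at hl'
          cases hl'
          exact absurd rfl hne
        · rw [Function.update_of_ne hll] at hl'
          rw [Finmap.lookup_insert_of_ne _ hll]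
          exact hη' l' j hl')
    refine ⟨_, .trans_right h₁ ?_, hC.sim (DComp.labels_inst (h₂.trans hsub) ?_) (h₄.insert ?_)
      (h₅.capture hl hκ hc hη hHl hN)⟩
    · have hlab : DVal.tr (Function.update η l (some (m, mc, i))) (.lab l) =
          triple (m, mc, i) := by simp [DVal.tr]
      rw [ACtx.plug_comp, DComp.tr_inst, ← hMtr, hlab]
      have := (running_yield m mc i (H.tr η) (M.tr η) (N.tr η) τ).inCtx D₁
      rwa [← APCtx.toCtx_plug] at this
    · rintro _ rfl
      exact ⟨_, Function.update_self ..⟩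
    · rintro _ ⟨⟩
      simp [APCtx.reify, APCtx.ren, APCtx.plug, AVal.active, AComp.active]

theorem Sim.throw_step {C : DCtx} {l : Label} {V : DVal} {H : DPCtx} {N : DComp} {θ : DStore}
    {c : AConf} (h : Sim (.conf (C.plug (.throw (.lab l) V)) θ) c)
    (hl : θ.lookup l = some (.full ⟨H, N⟩)) :
    ∃ c', APlus c c' ∧
      Sim (.conf (C.plug (.dollar (H.plug (.ret V)) N)) (θ.insert l .nil)) c' := by
  obtain ⟨η, κ, τ, D, L, h₁, h₂, h₃, h₄, h₅⟩ := h.decompose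
    (fun _ _ _ _ h => by cases h; assumption)
  have h₂ := Set.union_subset_iff.1 h₂
  obtain ⟨⟨z, zc, i⟩, hη⟩ : l ∈ pdom η := h₂.1 rfl
  have hκ := h₅.eta_kappa _ _ _ _ hη
  have hne := h₅.ne hκ hκ
  obtain ⟨-, hget, hothers, _, _, ⟨hH, rfl⟩, ⟨hN, rfl⟩, hz⟩ := h₅.live _ _ _ _ _ _ hη hl
  -- A live continuation is a stored value, while running coroutines are `nil`; hence `z` can be
  -- started inside the present context.
  have hzL : z ∉ L := fun h => by
    have := h₃.lookup z h
    rw [hz] at this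
    cases this
  have hothers' : ∀ l' j, η l' = some (z, zc, j) → (θ.insert l .nil).lookup l' = some .nil := by
    intro l' j hl'
    by_cases hll : l' = l
    · subst hll; exact Finmap.lookup_insert _
    · rw [Finmap.lookup_insert_of_ne _ hll]
      exact hothers l' (h₅.eta_dom.subset ⟨_, hl'⟩) hll _ _ hl'
  have hC := h₃.mono (η' := η) (κ' := κ) (θ' := θ.insert l .nil)
    (τ' := (τ.insert zc (.full (refCell (num (i + 1))))).insert z .nil) (fun _ _ h => h) (by
    intro m mc j hm hκm hc hn hηm
    have hmz : m ≠ z := fun h => hzL (h ▸ hm)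
    have hmc : mc ≠ zc := fun h => hmz (h₅.kappa_inj _ _ _ hκm (h ▸ hκ))
    refine ⟨hκm, (hc.insert hmc _).insert (h₅.ne hκ hκm) _, ?_, ?_⟩
    · rwa [Finmap.lookup_insert_of_ne _ hmz, Finmap.lookup_insert_of_ne _ (h₅.ne hκm hκ).symm]
    · intro l' k hl'
      by_cases hll : l' = l
      · subst hll; exact Finmap.lookup_insert _
      · rw [Finmap.lookup_insert_of_ne _ hll]
        exact hηm l' k hl')
  -- The reinstated delimiter enters as a running frame at the hole, not as a macro; its number is
  -- the incremented counter.
  have hC' := hC.comp (.running .hole ⟨hN, rfl⟩ (Set.notMem_empty z) hκ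
    ((GetNum.insert_self zc τ (i + 1)).insert hne _) (Finmap.lookup_insert _) hothers')
    (Set.disjoint_insert_right.2 ⟨hzL, Set.disjoint_empty L⟩)
  have hS := hC'.sim (M := H.plug (.ret V)) (DPCtx.labels_plug hH h₂.2)
    ((h₄.insert (by rintro _ ⟨⟩; simp [refCell_active])).insert (by rintro _ ⟨⟩))
    (h₅.throw hη hl)
  rw [DCtx.plug_comp] at hS
  refine ⟨_, .trans_right h₁ ?_, hS⟩
  have hlab : DVal.tr η (.lab l) = triple (z, zc, i) := by simp [DVal.tr, hη]
  rw [ACtx.plug_comp, DPCtx.plug_tr, DComp.tr, DComp.tr, hlab]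
  exact (throwMacro_run (H.tr η) (N.tr η) (V.tr η) hget hne hz).inCtx D

theorem Sim.fail_step {C : DCtx} {l : Label} {V : DVal} {θ : DStore}
    {c : AConf} (h : Sim (.conf (C.plug (.throw (.lab l) V)) θ) c)
    (hl : θ.lookup l = some .nil) : APlus c .bot := by
  obtain ⟨η, κ, τ, D, L, h₁, h₂, h₃, h₄, h₅⟩ := h.decompose
    (fun _ _ _ _ h => by cases h; assumption)
  obtain ⟨⟨z, zc, i⟩, hη⟩ : l ∈ pdom η := (Set.union_subset_iff.1 h₂).1 rfl
  obtain ⟨j, hj, hij⟩ := h₅.used _ _ _ _ hη hl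
  have hlab : DVal.tr η (.lab l) = triple (z, zc, i) := by simp [DVal.tr, hη]
  rw [DComp.tr, hlab] at h₁
  -- The number of a spent label is strictly below the counter, so the equality test is negative;
  -- `⊥` absorbs the surrounding context.
  exact .trans_right h₁ ((throwMacro_fail (V.tr η) hj hij.ne).inCtx D)

end DelToAC

theorem mainTheorem1 (C : DCtx) (M : DComp) (θ : DStore) (D : AConf) (R : DConf)
    (hsim : Sim (DConf.conf (C.plug M) θ) D) (hstep : DBeta M θ R) :
    ∃ D' : AConf, Relation.TransGen AStep D D' ∧ Sim (R.inCtx C) D' := by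
  cases hstep with
  | pcase V₁ V₂ M =>
    refine hsim.pure_step (fun _ _ _ _ h => by cases h; assumption) (fun S h => ?_)
      fun η τ => APlus.pcase (DComp.tr_inst2 η M V₁ V₂).symm
    have h := Set.union_subset_iff.1 h
    have h' := Set.union_subset_iff.1 h.1
    exact DComp.labels_inst2 h.2 h'.1 h'.2
  | scase L V B M _ hB =>
    refine hsim.pure_step (fun _ _ _ _ h => by cases h; assumption) (fun S h => ?_)
      fun η τ => APlus.scase (DBrs.find_tr η L hB) (DComp.tr_inst η M V).symm
    have h := Set.union_subset_iff.1 h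
    exact DComp.labels_inst (DBrs.labels_find hB h.2) h.1
  | force M =>
    exact hsim.pure_step (fun _ _ _ _ h => by cases h; assumption) (fun S h => h)
      fun η τ => APlus.beta (.force _ τ)
  | seq V M =>
    refine hsim.pure_step (fun _ _ _ _ h => ?_) (fun S h => ?_)
      fun η τ => DComp.tr_inst η M V ▸ APlus.beta (.seq _ _ τ)
    -- `Rel` is structural at a sequence, so inversion goes one level deeper: a `return` has only
    -- the translation clause.
    · cases h with
      | seq h hM =>
        cases h with
        | ret h => exact ⟨Set.union_subset h.1 hM.1, by rw [h.2, hM.2]; rfl⟩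
    · have h := Set.union_subset_iff.1 h
      exact DComp.labels_inst h.2 h.1
  | app M V =>
    refine hsim.pure_step (fun _ _ _ _ h => ?_) (fun S h => ?_)
      fun η τ => DComp.tr_inst η M V ▸ APlus.beta (.app _ _ τ)
    · cases h with
      | app h hV =>
        cases h with
        | lam h => exact ⟨Set.union_subset h.1 hV.1, by rw [h.2, hV.2]; rfl⟩
    · have h := Set.union_subset_iff.1 h
      exact DComp.labels_inst h.1 h.2
  | prj₁ M N =>
    refine hsim.pure_step (fun _ _ _ _ h => ?_) (fun S h => (Set.union_subset_iff.1 h).1)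
      fun η τ => APlus.beta (.prj₁ _ _ τ)
    cases h with
    | prj h =>
      cases h with
      | cpair h => exact ⟨h.1, by rw [h.2]; rfl⟩
  | prj₂ M N =>
    refine hsim.pure_step (fun _ _ _ _ h => ?_) (fun S h => (Set.union_subset_iff.1 h).2)
      fun η τ => APlus.beta (.prj₂ _ _ τ)
    cases h with
    | prj h =>
      cases h with
      | cpair h => exact ⟨h.1, by rw [h.2]; rfl⟩
  | ret V M => exact hsim.ret_step
  | shift H M N _ l hl => exact hsim.shift_step hl
  | throw l V H N _ hl => exact hsim.throw_step hl
  | fail l V _ hl => exact ⟨.bot, hsim.fail_step hl, .inl ⟨rfl, rfl⟩⟩
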